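/- Let $n\ge 2$, $1\le p<\infty$, $0<s<1$ with $sp<n$, put $p^*_s:=\frac{np}{n-sp}$, and let $p^*_s\le r<q<\infty$. Let $K,V:\mathbb{R}^n\to(0,\infty)$ be Lebesgue measurable functions such that (a) there is a $t\in\bigl(\frac{q}{q-r},\infty\bigr]$ with $K\in L^t(\Omega)$ for every measurable set $\Omega\subset\mathbb{R}^n$ of finite Lebesgue measure; (b) $V(x)\ge V_0$ for all $x\in\mathbb{R}^n$, for some constant $V_0>0$; (c) with $\tau:=\frac{r-p^*_s}{q-p^*_s}$, the function $KV^{-\tau}$ vanishes at infinity, that is, it is locally integrable and $\{x\in\mathbb{R}^n: K(x)V(x)^{-\tau}\ge c\}$ has finite Lebesgue measure for every $c>0$. Let $M_V^{s;q,p}(\mathbb{R}^n)$ be the Banach space obtained by completing the space of real-valued functions $u\in C^1_c(\mathbb{R}^n)$ of finite norm $$\|u\|:=\Bigl(\int_{\mathbb{R}^n}|u|^qV\,dx\Bigr)^{1/q}+\Bigl(\iint_{\mathbb{R}^n\times\mathbb{R}^n}\frac{|u(x)-u(y)|^p}{|x-y|^{n+sp}}\,dx\,dy\Bigr)^{1/p}$$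 with respect to this norm (if $V$ is locally integrable, these are all $u\in C^1_c(\mathbb{R}^n)$), and let $L^r(K;\mathbb{R}^n)$ be the space of (classes of) measurable functions with $\int_{\mathbb{R}^n}|u|^rK\,dx<\infty$. Then $M_V^{s;q,p}(\mathbb{R}^n)$ embeds compactly into $L^r(K;\mathbb{R}^n)$: each such $u\in C^1_c(\mathbb{R}^n)$ belongs to $L^r(K;\mathbb{R}^n)$, and the inclusion of these functions extends to an injective compact linear operator $M_V^{s;q,p}(\mathbb{R}^n)\to L^r(K;\mathbb{R}^n)$. -/

import Mathlib

open MeasureTheory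
open scoped ENNReal

noncomputable section

namespace FracSobolev

/-- `ℝⁿ` with the Euclidean norm and Lebesgue measure. -/
abbrev Rn (n : ℕ) : Type := EuclideanSpace ℝ (Fin n)

/-- The measure `w(x) dx` on `ℝⁿ`. -/
def weighted {n : ℕ} (w : Rn n → ℝ) : Measure (Rn n) :=
  volume.withDensity fun x => ENNReal.ofReal (w x)

/-- The fractional critical Sobolev exponent `p*_s = np / (n - sp)`. -/
def critExp (n : ℕ) (s p : ℝ) : ℝ := n * p / (n - s * p)

/-- A function `f` vanishes at infinity (Lieb and Loss): it is locally integrable and each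
superlevel set `{|f| ≥ c}`, `c > 0`, has finite Lebesgue measure. -/
def VanishesAtInfinity {n : ℕ} (f : Rn n → ℝ) : Prop :=
  LocallyIntegrable f volume ∧ ∀ c : ℝ, 0 < c → volume {x | c ≤ |f x|} < ∞

/-- The norm of `L^q(V; ℝⁿ)`, `(∫ |u|^q V dx)^{1/q}`, with values in `[0, ∞]`. -/
def weightedNorm {n : ℕ} (V : Rn n → ℝ) (q : ℝ) (u : Rn n → ℝ) : ℝ≥0∞ :=
  (∫⁻ x, ‖u x‖ₑ ^ q ∂(weighted V)) ^ (1 / q)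

/-- The Gagliardo seminorm
`[u]_{s,p} = (∬ |u(x) - u(y)|^p / |x - y|^{n + sp} dx dy)^{1/p}`, with values in `[0, ∞]`. -/
def gagliardo {n : ℕ} (s p : ℝ) (u : Rn n → ℝ) : ℝ≥0∞ :=
  (∫⁻ z : Rn n × Rn n, ‖u z.1 - u z.2‖ₑ ^ p / ‖z.1 - z.2‖ₑ ^ ((n : ℝ) + s * p)) ^ (1 / p)

/-- The norm `‖u‖_{L^q(V)} + [u]_{s,p}`, with values in `[0, ∞]`. -/
def mNorm {n : ℕ} (s q p : ℝ) (V : Rn n → ℝ) (u : Rn n → ℝ) : ℝ≥0∞ :=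
  weightedNorm V q u + gagliardo s p u

section Norm

variable {n : ℕ} {s p q : ℝ} {V u v : Rn n → ℝ}

theorem weightedNorm_zero (hq : 1 ≤ q) : weightedNorm V q (0 : Rn n → ℝ) = 0 := by
  have hq0 : 0 < q := by linarith
  simp [weightedNorm, hq0]

theorem gagliardo_zero (hp : 1 ≤ p) : gagliardo s p (0 : Rn n → ℝ) = 0 := by
  have hp0 : 0 < p := by linarith
  simp [gagliardo, hp0]

theorem weightedNorm_add (hq : 1 ≤ q) (hu : Continuous u) (hv : Continuous v) :
    weightedNorm V q (u + v) ≤ weightedNorm V q u + weightedNorm V q v := by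
  have hq0 : 0 < q := by linarith
  unfold weightedNorm
  refine le_trans ?_ (ENNReal.lintegral_Lp_add_le (μ := weighted V)
    (f := fun x => ‖u x‖ₑ) (g := fun x => ‖v x‖ₑ)
    hu.measurable.enorm.aemeasurable hv.measurable.enorm.aemeasurable hq)
  gcongr
  exact enorm_add_le _ _

/-- The measure `|x - y|^{-(n + sp)} dx dy`. -/
def kernelMeasure (n : ℕ) (s p : ℝ) : Measure (Rn n × Rn n) :=
  volume.withDensity fun z => (‖z.1 - z.2‖ₑ ^ ((n : ℝ) + s * p))⁻¹

theorem gagliardo_eq (hu : Continuous u) :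
    gagliardo s p u = (∫⁻ z, ‖u z.1 - u z.2‖ₑ ^ p ∂(kernelMeasure n s p)) ^ (1 / p) := by
  unfold gagliardo kernelMeasure
  rw [lintegral_withDensity_eq_lintegral_mul _ (by fun_prop)]
  · congr 1
    refine lintegral_congr fun z => ?_
    rw [Pi.mul_apply, div_eq_mul_inv, mul_comm]
  · have hm := hu.measurable
    fun_prop

theorem gagliardo_add (hp : 1 ≤ p) (hu : Continuous u) (hv : Continuous v) :
    gagliardo s p (u + v) ≤ gagliardo s p u + gagliardo s p v := by
  have hp0 : 0 < p := by linarith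
  rw [gagliardo_eq hu, gagliardo_eq hv, gagliardo_eq (hu.add hv)]
  have hmu := hu.measurable
  have hmv := hv.measurable
  refine le_trans ?_ (ENNReal.lintegral_Lp_add_le (μ := kernelMeasure n s p)
    (f := fun z => ‖u z.1 - u z.2‖ₑ) (g := fun z => ‖v z.1 - v z.2‖ₑ)
    (by fun_prop) (by fun_prop) hp)
  gcongr with z
  simp only [Pi.add_apply]
  rw [add_sub_add_comm]
  exact enorm_add_le _ _

theorem weightedNorm_smul (hq : 1 ≤ q) (c : ℝ) (hu : Continuous u) :
    weightedNorm V q (c • u) = ‖c‖ₑ * weightedNorm V q u := by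
  have hq0 : 0 < q := by linarith
  unfold weightedNorm
  simp only [Pi.smul_apply, smul_eq_mul, enorm_mul, ENNReal.mul_rpow_of_nonneg _ _ hq0.le]
  rw [lintegral_const_mul _ (by have := hu.measurable; fun_prop),
    ENNReal.mul_rpow_of_nonneg _ _ (by positivity), ← ENNReal.rpow_mul,
    mul_one_div_cancel hq0.ne', ENNReal.rpow_one]

theorem gagliardo_smul (hp : 1 ≤ p) (c : ℝ) (hu : Continuous u) :
    gagliardo s p (c • u) = ‖c‖ₑ * gagliardo s p u := by
  have hp0 : 0 < p := by linarith
  rw [gagliardo_eq hu, gagliardo_eq (hu.const_smul c)]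
  simp only [Pi.smul_apply, smul_eq_mul, ← mul_sub, enorm_mul,
    ENNReal.mul_rpow_of_nonneg _ _ hp0.le]
  rw [lintegral_const_mul _ (by have := hu.measurable; fun_prop),
    ENNReal.mul_rpow_of_nonneg _ _ (by positivity), ← ENNReal.rpow_mul,
    mul_one_div_cancel hp0.ne', ENNReal.rpow_one]

theorem mNorm_add (hq : 1 ≤ q) (hp : 1 ≤ p) (hu : Continuous u) (hv : Continuous v) :
    mNorm s q p V (u + v) ≤ mNorm s q p V u + mNorm s q p V v := by
  unfold mNorm
  rw [add_add_add_comm]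
  exact add_le_add (weightedNorm_add hq hu hv) (gagliardo_add hp hu hv)

theorem mNorm_smul (hq : 1 ≤ q) (hp : 1 ≤ p) (c : ℝ) (hu : Continuous u) :
    mNorm s q p V (c • u) = ‖c‖ₑ * mNorm s q p V u := by
  unfold mNorm
  rw [weightedNorm_smul hq c hu, gagliardo_smul hp c hu, mul_add]

end Norm

/-- The functions of class `C¹` with compact support in `ℝⁿ` whose norm
`‖u‖_{L^q(V)} + [u]_{s,p}` is finite. For `V` locally integrable (and `0 < s < 1 ≤ p`)
these are all the compactly supported `C¹` functions. -/
def testSubmodule (n : ℕ) (s q p : ℝ) [hq : Fact (1 ≤ q)] [hp : Fact (1 ≤ p)]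
    (V : Rn n → ℝ) : Submodule ℝ (Rn n → ℝ) where
  carrier := {u | ContDiff ℝ 1 u ∧ HasCompactSupport u ∧ mNorm s q p V u < ∞}
  zero_mem' := ⟨contDiff_const, HasCompactSupport.zero, by
    simp [mNorm, weightedNorm_zero hq.out, gagliardo_zero hp.out]⟩
  add_mem' := fun {u v} hu hv => ⟨hu.1.add hv.1, hu.2.1.add hv.2.1,
    (mNorm_add hq.out hp.out hu.1.continuous hv.1.continuous).trans_lt
      (ENNReal.add_lt_top.2 ⟨hu.2.2, hv.2.2⟩)⟩
  smul_mem' := fun c u hu => ⟨hu.1.const_smul c, hu.2.1.smul_left (f := fun _ => c), by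
    rw [mNorm_smul hq.out hp.out c hu.1.continuous]
    exact ENNReal.mul_lt_top enorm_lt_top hu.2.2⟩

/-- The space of test functions, to be normed by `‖u‖_{L^q(V)} + [u]_{s,p}`. -/
def TestSpace (n : ℕ) (s q p : ℝ) [Fact (1 ≤ q)] [Fact (1 ≤ p)] (V : Rn n → ℝ) : Type :=
  testSubmodule n s q p V

section TestSpace

variable {n : ℕ} {s q p : ℝ} [hq : Fact (1 ≤ q)] [hp : Fact (1 ≤ p)] {V : Rn n → ℝ}

instance : AddCommGroup (TestSpace n s q p V) :=
  inferInstanceAs (AddCommGroup (testSubmodule n s q p V))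

instance : Module ℝ (TestSpace n s q p V) :=
  inferInstanceAs (Module ℝ (testSubmodule n s q p V))

/-- The underlying function of a test function. -/
def TestSpace.toFun (u : TestSpace n s q p V) : Rn n → ℝ := u.1

instance : Norm (TestSpace n s q p V) := ⟨fun u => (mNorm s q p V u.toFun).toReal⟩

theorem TestSpace.norm_core :
    SeminormedSpace.Core ℝ (TestSpace n s q p V) where
  norm_nonneg _ := ENNReal.toReal_nonneg
  norm_smul c u := by
    change (mNorm s q p V (c • u.1)).toReal = ‖c‖ * (mNorm s q p V u.1).toReal
    rw [mNorm_smul hq.out hp.out c u.2.1.continuous, ENNReal.toReal_mul, toReal_enorm]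
  norm_triangle u v := by
    change (mNorm s q p V (u.1 + v.1)).toReal ≤
      (mNorm s q p V u.1).toReal + (mNorm s q p V v.1).toReal
    rw [← ENNReal.toReal_add u.2.2.2.ne v.2.2.2.ne]
    exact ENNReal.toReal_mono (ENNReal.add_ne_top.2 ⟨u.2.2.2.ne, v.2.2.2.ne⟩)
      (mNorm_add hq.out hp.out u.2.1.continuous v.2.1.continuous)

instance : SeminormedAddCommGroup (TestSpace n s q p V) :=
  SeminormedAddCommGroup.ofCore (𝕜 := ℝ) TestSpace.norm_core

instance : NormedSpace ℝ (TestSpace n s q p V) where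
  norm_smul_le c u := (TestSpace.norm_core.norm_smul c u).le

end TestSpace

/-- The Banach space `M_V^{s;q,p}(ℝⁿ)`: the completion of the test functions with respect to
the norm `‖u‖_{L^q(V)} + [u]_{s,p}`. -/
abbrev MSpace (n : ℕ) (s q p : ℝ) [Fact (1 ≤ q)] [Fact (1 ≤ p)] (V : Rn n → ℝ) : Type :=
  UniformSpace.Completion (TestSpace n s q p V)

instance {r : ℝ} [hr : Fact (1 ≤ r)] : Fact (1 ≤ ENNReal.ofReal r) :=
  ⟨ENNReal.one_le_ofReal.2 hr.out⟩

/-- The weighted Lebesgue space `L^r(K; ℝⁿ)`, that is `L^r` of the measure `K(x) dx`. -/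
abbrev LrK (n : ℕ) (r : ℝ) (K : Rn n → ℝ) :=
  Lp ℝ (ENNReal.ofReal r) (weighted K)

end FracSobolev

end

/-! Everything rests on the pointwise inequality `enorm_le_of_mem_ball`: for `x` in a ball of radius
`d`, `|u(x)|` is at most `C d^s D(x)^{1/p}` plus the modulus of the mean of `u` over the ball, where
the density `D` integrates to `[u]_{s,p}^p`. With the ball centred at `x`, the mean estimated by
Hölder and the radius optimised, it gives the fractional Sobolev inequality. With a finite cover of
a bounded set by balls of small fixed radius, it shows that a function of bounded seminorm whose
means over these balls are small is small in `L^p` there.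

The core is `exists_finset_lintegral_weighted_le`: for `‖u‖ ≤ 1`, smallness of finitely many ball
integrals forces smallness in `L^r(K)`. Off a set `E` of finite measure, `K V^{-τ}` is small, and
interpolation bounds `K|u|^r` by a small multiple of `|u|^{p*_s} + |u|^q V`. On the part of `E`
where `|x|` or `K` is large, Young's inequality leaves a tail of the integral of `K^{q/(q-r)}` over
`E`, finite because `K ∈ L^t(E)`, and a small multiple of `|u|^q`, integrable since `V ≥ V₀`. On the
rest, bounded and with `K` bounded, `|u|^r` is absorbed by `|u|^p`, small by the local estimate, and
a small multiple of `|u|^q`.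

Ball integrals are continuous functionals, so this control by finite-dimensional data yields
continuity and total boundedness (`IsFinitelyControlled`), hence a compact extension to the
completion. For injectivity, a Cauchy sequence of test functions whose images tend to `0` has a
subsequence tending to `0` almost everywhere; Fatou's lemma applied to differences makes its norms
tend to `0`. -/

noncomputable section

namespace FracSobolev

/-! ### Pointwise control by the Gagliardo density and ball means -/

section Gagliardo

variable {n : ℕ} {s p : ℝ} {u : Rn n → ℝ}

/-- The density `x ↦ ∫ |u(x) - u(y)|^p / |x - y|^{n + sp} dy` of the Gagliardo seminorm. -/
def gagliardoDensity (s p : ℝ) (u : Rn n → ℝ) (x : Rn n) : ℝ≥0∞ :=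
  ∫⁻ y, ‖u x - u y‖ₑ ^ p / ‖x - y‖ₑ ^ ((n : ℝ) + s * p)

theorem measurable_gagliardo_integrand (hu : Continuous u) :
    Measurable fun z : Rn n × Rn n =>
      ‖u z.1 - u z.2‖ₑ ^ p / ‖z.1 - z.2‖ₑ ^ ((n : ℝ) + s * p) := by
  have hm := hu.measurable
  fun_prop

theorem measurable_gagliardoDensity (hu : Continuous u) :
    Measurable (gagliardoDensity s p u) :=
  (measurable_gagliardo_integrand hu).lintegral_prod_right'

theorem lintegral_gagliardoDensity (hp : 0 < p) (hu : Continuous u) :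
    ∫⁻ x, gagliardoDensity s p u x = gagliardo s p u ^ p := by
  unfold gagliardo
  rw [← ENNReal.rpow_mul, one_div_mul_cancel hp.ne', ENNReal.rpow_one, Measure.volume_eq_prod,
    lintegral_prod _ (measurable_gagliardo_integrand hu).aemeasurable]
  rfl

/-- For `y ∈ S` the kernel `|x - y|^{-(n+sp)}` is at least `d^{-(n+sp)}`, so it can be inserted at
the cost of `d^{n+sp}`. -/
theorem setLIntegral_enorm_sub_rpow_le (hp : 0 < p) (hs : 0 < s) {S : Set (Rn n)}
    (hS : MeasurableSet S) {x : Rn n} {d : ℝ} (hd : ∀ y ∈ S, ‖x - y‖ ≤ d) :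
    ∫⁻ y in S, ‖u x - u y‖ₑ ^ p ≤
      ENNReal.ofReal d ^ ((n : ℝ) + s * p) * gagliardoDensity s p u x := by
  have he : 0 < (n : ℝ) + s * p := by positivity
  rcases S.eq_empty_or_nonempty with rfl | ⟨y₀, hy₀⟩
  · simp
  calc ∫⁻ y in S, ‖u x - u y‖ₑ ^ p
      ≤ ∫⁻ y in S, ENNReal.ofReal d ^ ((n : ℝ) + s * p) *
          (‖u x - u y‖ₑ ^ p / ‖x - y‖ₑ ^ ((n : ℝ) + s * p)) := by
        refine setLIntegral_mono' hS fun y hy => ?_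
        by_cases hxy : x = y
        · simp [hxy, hp]
        have h0 : ‖x - y‖ₑ ^ ((n : ℝ) + s * p) ≠ 0 := by
          simp [ENNReal.rpow_eq_zero_iff, sub_eq_zero, hxy]
        have h1 : ‖x - y‖ₑ ^ ((n : ℝ) + s * p) ≠ ∞ :=
          ENNReal.rpow_ne_top_of_nonneg he.le enorm_ne_top
        calc ‖u x - u y‖ₑ ^ p = ‖x - y‖ₑ ^ ((n : ℝ) + s * p) *
              (‖u x - u y‖ₑ ^ p / ‖x - y‖ₑ ^ ((n : ℝ) + s * p)) :=
              (ENNReal.mul_div_cancel h0 h1).symm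
          _ ≤ _ := by
              gcongr
              rw [← ofReal_norm]
              exact ENNReal.ofReal_le_ofReal (hd y hy)
    _ ≤ ∫⁻ y, ENNReal.ofReal d ^ ((n : ℝ) + s * p) *
          (‖u x - u y‖ₑ ^ p / ‖x - y‖ₑ ^ ((n : ℝ) + s * p)) := setLIntegral_le_lintegral _ _
    _ = _ := by
        rw [lintegral_const_mul' _ _ (ENNReal.rpow_ne_top_of_nonneg he.le ENNReal.ofReal_ne_top)]
        rfl

/-- Hölder's inequality against the constant function `1`. -/
theorem lintegral_enorm_le_rpow_mul_measure {α : Type*} [MeasurableSpace α] {μ : Measure α}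
    {f : α → ℝ} (hf : AEStronglyMeasurable f μ) {a : ℝ} (ha : 1 ≤ a) :
    ∫⁻ x, ‖f x‖ₑ ∂μ ≤ (∫⁻ x, ‖f x‖ₑ ^ a ∂μ) ^ (1 / a) * μ Set.univ ^ (1 - 1 / a) := by
  simpa [eLpNorm'] using eLpNorm'_le_eLpNorm'_mul_rpow_measure_univ one_pos ha hf

/-- The constant in `enorm_le_of_mem_ball`. -/
def ballConst (n : ℕ) (s p : ℝ) : ℝ≥0∞ :=
  (2 ^ ((n : ℝ) + s * p) / volume (Metric.ball (0 : Rn n) 1)) ^ (1 / p)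

theorem ballConst_ne_top (hp : 0 < p) (hs : 0 < s) : ballConst n s p ≠ ∞ := by
  refine ENNReal.rpow_ne_top_of_nonneg (by positivity) (ENNReal.div_ne_top ?_ ?_)
  · exact ENNReal.rpow_ne_top_of_nonneg (by positivity) (by simp)
  · exact (Metric.measure_ball_pos volume _ one_pos).ne'

theorem volume_ball_eq (z : Rn n) {d : ℝ} (hd : 0 < d) :
    volume (Metric.ball z d) = ENNReal.ofReal d ^ (n : ℝ) * volume (Metric.ball (0 : Rn n) 1) := by
  rw [Measure.addHaar_ball_of_pos _ _ hd, ENNReal.ofReal_pow hd.le, ENNReal.rpow_natCast]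
  simp

/-- A continuous function is compared with its mean over a ball through the density of the
Gagliardo seminorm. -/
theorem enorm_le_of_mem_ball (hp : 1 ≤ p) (hs : 0 < s) (hu : Continuous u) {x z : Rn n} {d : ℝ}
    (hx : x ∈ Metric.ball z d) :
    ‖u x‖ₑ ≤ ballConst n s p * ENNReal.ofReal d ^ s * gagliardoDensity s p u x ^ (1 / p) +
      (volume (Metric.ball z d))⁻¹ * ‖∫ y in Metric.ball z d, u y‖ₑ := by
  have hp0 : 0 < p := by linarith
  have hd : 0 < d := (dist_nonneg).trans_lt (Metric.mem_ball.1 hx)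
  set B := Metric.ball z d with hB
  have hB0 : volume B ≠ 0 := (Metric.measure_ball_pos volume _ hd).ne'
  have hBt : volume B ≠ ∞ := measure_ball_lt_top.ne
  have : IsFiniteMeasure (volume.restrict B) := ⟨by simpa using hBt.lt_top⟩
  have hint : IntegrableOn u B :=
    (hu.locallyIntegrable.integrableOn_isCompact (isCompact_closedBall z d)).mono_set
      Metric.ball_subset_closedBall
  -- Integrate `u(x) = (u(x) - u(y)) + u(y)` over `y ∈ B`; the first part is estimated by Hölder and
  -- the density, the second is kept as a mean.
  have hsplit : ‖u x‖ₑ * volume B ≤ (∫⁻ y in B, ‖u x - u y‖ₑ) + ‖∫ y in B, u y‖ₑ := by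
    have h1 : ∫ y in B, (u x - u y) = volume.real B * u x - ∫ y in B, u y := by
      rw [integral_sub (integrable_const _) hint]
      simp
    have h2 : volume.real B * u x = (∫ y in B, (u x - u y)) + ∫ y in B, u y := by rw [h1]; ring
    calc ‖u x‖ₑ * volume B = ‖volume.real B * u x‖ₑ := by
          rw [enorm_mul, mul_comm, Measure.real,
            Real.enorm_of_nonneg ENNReal.toReal_nonneg, ENNReal.ofReal_toReal hBt]
      _ ≤ ‖∫ y in B, (u x - u y)‖ₑ + ‖∫ y in B, u y‖ₑ := by rw [h2]; exact enorm_add_le _ _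
      _ ≤ _ := by gcongr; exact enorm_integral_le_lintegral_enorm _
  have hdiam : ∀ y ∈ B, ‖x - y‖ ≤ 2 * d := fun y hy => by
    rw [← dist_eq_norm]
    have h1 := Metric.mem_ball.1 hx
    have h2 := Metric.mem_ball'.1 hy
    linarith [dist_triangle x z y]
  have hmain : ∫⁻ y in B, ‖u x - u y‖ₑ ≤
      (ENNReal.ofReal (2 * d) ^ ((n : ℝ) + s * p) * gagliardoDensity s p u x) ^ (1 / p) *
        volume B ^ (1 - 1 / p) := by
    have h := lintegral_enorm_le_rpow_mul_measure (μ := volume.restrict B)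
      (f := fun y => u x - u y) (by fun_prop) hp
    refine h.trans ?_
    rw [Measure.restrict_apply_univ]
    gcongr
    exact setLIntegral_enorm_sub_rpow_le hp0 hs measurableSet_ball hdiam
  have hdiv : ‖u x‖ₑ ≤ ((∫⁻ y in B, ‖u x - u y‖ₑ) + ‖∫ y in B, u y‖ₑ) * (volume B)⁻¹ := by
    rw [← div_eq_mul_inv]
    exact (ENNReal.le_div_iff_mul_le (Or.inl hB0) (Or.inl hBt)).2 hsplit
  refine hdiv.trans ?_
  rw [add_mul, mul_comm (volume B)⁻¹]
  refine add_le_add ((mul_le_mul_left hmain _).trans (le_of_eq ?_)) le_rfl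
  have hb0 : volume (Metric.ball (0 : Rn n) 1) ≠ 0 := (Metric.measure_ball_pos volume _ one_pos).ne'
  have hbt : volume (Metric.ball (0 : Rn n) 1) ≠ ∞ := measure_ball_lt_top.ne
  have hd0 : ENNReal.ofReal d ≠ 0 := by simpa using hd
  have hdt : ENNReal.ofReal d ≠ ∞ := ENNReal.ofReal_ne_top
  have hp1 : (0 : ℝ) ≤ 1 / p := by positivity
  have hvol : volume B ^ (1 - 1 / p) * (volume B)⁻¹ = (volume B)⁻¹ ^ (1 / p) := by
    rw [← ENNReal.rpow_neg_one, ← ENNReal.rpow_add _ _ hB0 hBt, ← ENNReal.rpow_mul]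
    congr 1; ring
  rw [mul_assoc, hvol, ENNReal.mul_rpow_of_nonneg _ _ hp1, ballConst, mul_right_comm]
  congr 1
  rw [← ENNReal.mul_rpow_of_nonneg _ _ hp1, hB, volume_ball_eq z hd,
    show ENNReal.ofReal d ^ s = (ENNReal.ofReal d ^ (s * p)) ^ (1 / p) by
      rw [← ENNReal.rpow_mul]; congr 1; field_simp,
    ← ENNReal.mul_rpow_of_nonneg _ _ hp1]
  congr 1
  rw [ENNReal.ofReal_mul zero_le_two, ENNReal.mul_rpow_of_nonneg _ _ (by positivity),
    ENNReal.rpow_add _ _ hd0 hdt, ENNReal.mul_inv (by right; exact hbt) (by right; exact hb0),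
    div_eq_mul_inv]
  have hc : ENNReal.ofReal d ^ (n : ℝ) * (ENNReal.ofReal d ^ (n : ℝ))⁻¹ = 1 :=
    ENNReal.mul_inv_cancel (by simp [hd]) (by simp)
  simp only [ENNReal.ofReal_ofNat]
  calc _ = (2 ^ ((n : ℝ) + s * p) * (volume (Metric.ball (0 : Rn n) 1))⁻¹ *
        ENNReal.ofReal d ^ (s * p)) * (ENNReal.ofReal d ^ (n : ℝ) *
        (ENNReal.ofReal d ^ (n : ℝ))⁻¹) := by ring
    _ = _ := by rw [hc, mul_one]

end Gagliardo

/-! ### The fractional Sobolev inequality -/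

/-- Optimisation over the scale `ρ` in the pointwise inequality that leads to the fractional
Sobolev inequality. -/
theorem rpow_le_of_forall_scale {a δ A C N s p : ℝ} (ha : 0 ≤ a) (hδ : 0 ≤ δ) (hA : 0 < A)
    (hC : 0 ≤ C) (hp : 0 < p) (hs : 0 < s) (hsp : s * p < N)
    (h : ∀ ρ > 0, a ≤ C * (ρ ^ s * δ + ρ ^ (-((N - s * p) / p)) * A)) :
    a ^ (N * p / (N - s * p)) ≤
      (2 * C) ^ (N * p / (N - s * p)) * A ^ (s * p ^ 2 / (N - s * p)) * δ ^ p := by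
  have hsp0 : 0 < s * p := by positivity
  have hN : 0 < N := by linarith
  have hNs : 0 < N - s * p := by linarith
  rcases hδ.eq_or_lt with rfl | hδ
  -- With `δ = 0` only the decaying term remains, and `ρ → ∞` gives `a = 0`.
  · have hlim : Filter.Tendsto (fun ρ : ℝ => C * (ρ ^ s * 0 + ρ ^ (-((N - s * p) / p)) * A))
        Filter.atTop (nhds (C * (0 + 0 * A))) := by
      simp only [mul_zero, zero_add]
      exact ((tendsto_rpow_neg_atTop (by positivity)).mul_const A).const_mul C
    have ha0 : a ≤ C * (0 + 0 * A) :=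
      ge_of_tendsto hlim ((Filter.eventually_gt_atTop 0).mono fun ρ hρ => h ρ hρ)
    have : a = 0 := le_antisymm (by simpa using ha0) ha
    rw [this, Real.zero_rpow (by positivity), Real.zero_rpow hp.ne', mul_zero]
  · have hq : 0 < A / δ := by positivity
    -- This scale makes the two terms equal, because `s + (N - sp)/p = N/p`.
    have hρ := h ((A / δ) ^ (p / N)) (by positivity)
    have e1 : ((A / δ) ^ (p / N)) ^ s * δ = A ^ (s * p / N) * δ ^ (1 - s * p / N) := by
      rw [← Real.rpow_mul hq.le, Real.div_rpow hA.le hδ.le, Real.rpow_sub hδ, Real.rpow_one]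
      rw [show p / N * s = s * p / N by ring]
      ring
    have e2 : ((A / δ) ^ (p / N)) ^ (-((N - s * p) / p)) * A =
        A ^ (s * p / N) * δ ^ (1 - s * p / N) := by
      rw [← Real.rpow_mul hq.le,
        show p / N * (-((N - s * p) / p)) = s * p / N - 1 by field_simp; ring,
        Real.div_rpow hA.le hδ.le, Real.rpow_sub hA, Real.rpow_one,
        show 1 - s * p / N = -(s * p / N - 1) by ring, Real.rpow_neg hδ.le]
      field_simp
    rw [e1, e2] at hρ
    have hρ' : a ≤ 2 * C * (A ^ (s * p / N) * δ ^ (1 - s * p / N)) := by linarith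
    refine (Real.rpow_le_rpow ha hρ' (by positivity)).trans (le_of_eq ?_)
    rw [Real.mul_rpow (x := 2 * C) (by positivity) (by positivity),
      Real.mul_rpow (x := A ^ _) (by positivity) (by positivity), ← Real.rpow_mul hA.le, ← Real.rpow_mul hδ.le, mul_assoc]
    congr 3
    · field_simp
    · field_simp

section Sobolev

variable {n : ℕ} {s p : ℝ} {u : Rn n → ℝ}

theorem le_critExp (hp : 0 < p) (hs : 0 < s) (hsp : s * p < n) : p ≤ critExp n s p := by
  unfold critExp
  rw [le_div_iff₀ (by linarith)]
  nlinarith [mul_pos hs hp]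

/-- Hölder on `B`. For a ball of radius `ρ` and `a = p*_s`, the factor `μ(B)^{-1/a}` is the power
`ρ^{-(n-sp)/p}` that competes with `ρ^s`. -/
theorem measure_inv_mul_enorm_setIntegral_le {α : Type*} [MeasurableSpace α] {μ : Measure α}
    {B : Set α} (hB0 : μ B ≠ 0) (hBt : μ B ≠ ∞) {f : α → ℝ} (hf : AEStronglyMeasurable f μ)
    {a : ℝ} (ha : 1 ≤ a) :
    (μ B)⁻¹ * ‖∫ y in B, f y ∂μ‖ₑ ≤ (∫⁻ y, ‖f y‖ₑ ^ a ∂μ) ^ (1 / a) * (μ B)⁻¹ ^ (1 / a) := by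
  have ha0 : 0 < a := by linarith
  calc (μ B)⁻¹ * ‖∫ y in B, f y ∂μ‖ₑ
      ≤ (μ B)⁻¹ * ((∫⁻ y, ‖f y‖ₑ ^ a ∂μ) ^ (1 / a) * μ B ^ (1 - 1 / a)) := by
        gcongr
        refine (enorm_integral_le_lintegral_enorm _).trans
          ((lintegral_enorm_le_rpow_mul_measure hf.restrict ha).trans ?_)
        rw [Measure.restrict_apply_univ]
        gcongr
        exact Measure.restrict_le_self
    _ = (∫⁻ y, ‖f y‖ₑ ^ a ∂μ) ^ (1 / a) * (μ B ^ (-1 : ℝ) * μ B ^ (1 - 1 / a)) := by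
        rw [ENNReal.rpow_neg_one]; ring
    _ = _ := by
        rw [← ENNReal.rpow_add _ _ hB0 hBt, ENNReal.inv_rpow, ← ENNReal.rpow_neg]
        congr 2; ring

theorem lintegral_enorm_rpow_lt_top (hu : Continuous u) (hc : HasCompactSupport u) {a : ℝ}
    (ha : 0 < a) : ∫⁻ x, ‖u x‖ₑ ^ a < ∞ := by
  have h := (hu.memLp_of_hasCompactSupport (p := ENNReal.ofReal a) (μ := volume) hc).eLpNorm_lt_top
  rw [eLpNorm_lt_top_iff_lintegral_rpow_enorm_lt_top (by simpa using ha) (by simp)] at h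
  rwa [ENNReal.toReal_ofReal ha.le] at h

/-- The constant in the pointwise inequality `enorm_rpow_critExp_le`. -/
def sobolevConst (n : ℕ) (s p : ℝ) : ℝ≥0∞ :=
  (2 * (ballConst n s p +
    (volume (Metric.ball (0 : Rn n) 1))⁻¹ ^ (1 / critExp n s p))) ^ critExp n s p

theorem sobolevConst_ne_top (hp : 1 ≤ p) (hs : 0 < s) (hsp : s * p < n) :
    sobolevConst n s p ≠ ∞ := by
  have hp0 : 0 < p := by linarith
  have hc0 : 0 < critExp n s p := hp0.trans_le (le_critExp hp0 hs hsp)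
  refine ENNReal.rpow_ne_top_of_nonneg hc0.le (ENNReal.mul_ne_top (by simp)
    (ENNReal.add_ne_top.2 ⟨ballConst_ne_top hp0 hs, ENNReal.rpow_ne_top_of_nonneg (by positivity) ?_⟩))
  simpa using (Metric.measure_ball_pos volume (0 : Rn n) one_pos).ne'

/-- Balls centred at `x` give a bound at every scale `ρ`, and the best scale turns it into a bound
linear in the density, ready to be integrated over `x`. -/
theorem enorm_rpow_critExp_le (hp : 1 ≤ p) (hs : 0 < s) (hsp : s * p < n) (hu : Continuous u)
    (hc : HasCompactSupport u) (hI : ∫⁻ y, ‖u y‖ₑ ^ critExp n s p ≠ 0) (x : Rn n) :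
    ‖u x‖ₑ ^ critExp n s p ≤ sobolevConst n s p *
      (∫⁻ y, ‖u y‖ₑ ^ critExp n s p) ^ (s * p / n) * gagliardoDensity s p u x := by
  have hp0 : 0 < p := by linarith
  have hsp0 : 0 < s * p := by positivity
  have hns : 0 < (n : ℝ) - s * p := by linarith
  have hn : 0 < (n : ℝ) := by linarith
  have hpc := le_critExp hp0 hs hsp
  have hc0 : 0 < critExp n s p := by linarith
  set c := critExp n s p with hcdef
  have hcr : c = n * p / (n - s * p) := rfl
  set I := ∫⁻ y, ‖u y‖ₑ ^ c with hIdef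
  have hIt : I ≠ ∞ := (lintegral_enorm_rpow_lt_top hu hc hc0).ne
  -- Non-vanishing of the constant is what makes the right side `∞` when the density is infinite;
  -- otherwise the bound is proved in the reals.
  have hS0 : sobolevConst n s p ≠ 0 := by
    have hb : (volume (Metric.ball (0 : Rn n) 1))⁻¹ ^ (1 / c) ≠ 0 := by
      simp [ENNReal.rpow_eq_zero_iff, hc0, hc0.le, measure_ball_lt_top.ne]
    have hbase : 2 * (ballConst n s p +
        (volume (Metric.ball (0 : Rn n) 1))⁻¹ ^ (1 / c)) ≠ 0 :=
      mul_ne_zero two_ne_zero fun h => hb (add_eq_zero.1 h).2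
    simp only [sobolevConst, ← hcdef, Ne, ENNReal.rpow_eq_zero_iff, not_or, not_and]
    exact ⟨fun h => absurd h hbase, fun _ => hc0.not_gt⟩
  have hI0' : I ^ (s * p / n) ≠ 0 := by simp [ENNReal.rpow_eq_zero_iff, hI, hIt]
  by_cases hD : gagliardoDensity s p u x = ∞
  · rw [hD, ENNReal.mul_top (mul_ne_zero hS0 hI0')]
    exact le_top
  set D := gagliardoDensity s p u x with hDdef
  set b := volume (Metric.ball (0 : Rn n) 1) with hb
  have hb0 : b ≠ 0 := (Metric.measure_ball_pos volume _ one_pos).ne'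
  have hbt : b ≠ ∞ := measure_ball_lt_top.ne
  set C := ballConst n s p + b⁻¹ ^ (1 / c) with hC
  have hbi : b⁻¹ ^ (1 / c) ≠ ∞ := ENNReal.rpow_ne_top_of_nonneg (by positivity) (by simpa using hb0)
  have hCt : C ≠ ∞ := ENNReal.add_ne_top.2 ⟨ballConst_ne_top hp0 hs, hbi⟩
  have hDp : D ^ (1 / p) ≠ ∞ := ENNReal.rpow_ne_top_of_nonneg (by positivity) hD
  have hIc : I ^ (1 / c) ≠ ∞ := ENNReal.rpow_ne_top_of_nonneg (by positivity) hIt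
  have hIc0 : I ^ (1 / c) ≠ 0 := by simp [ENNReal.rpow_eq_zero_iff, hI, hIt]
  have hscale : ∀ ρ : ℝ, 0 < ρ → ‖u x‖ₑ ≤ C * (ENNReal.ofReal ρ ^ s * D ^ (1 / p) +
      ENNReal.ofReal ρ ^ (-((n - s * p) / p)) * I ^ (1 / c)) := by
    intro ρ hρ
    refine (enorm_le_of_mem_ball hp hs hu (Metric.mem_ball_self hρ)).trans ?_
    rw [mul_add]
    refine add_le_add ?_ ?_
    · rw [mul_assoc]; gcongr; exact le_self_add
    · refine (measure_inv_mul_enorm_setIntegral_le (Metric.measure_ball_pos volume _ hρ).ne'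
        measure_ball_lt_top.ne hu.aestronglyMeasurable (by linarith : 1 ≤ c)).trans ?_
      rw [volume_ball_eq x hρ, ← hIdef, ← hb, ENNReal.mul_inv (by right; exact hbt) (by right; exact hb0),
        ENNReal.mul_rpow_of_nonneg _ _ (by positivity), ← ENNReal.rpow_neg, ← ENNReal.rpow_mul,
        show -(n : ℝ) * (1 / c) = -((n - s * p) / p) by rw [hcr]; field_simp]
      calc _ = b⁻¹ ^ (1 / c) * (ENNReal.ofReal ρ ^ (-((n - s * p) / p)) * I ^ (1 / c)) := by ring
        _ ≤ _ := by gcongr; exact le_add_self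
  have hreal := rpow_le_of_forall_scale (a := ‖u x‖) (δ := (D ^ (1 / p)).toReal)
    (A := (I ^ (1 / c)).toReal) (C := C.toReal) (N := n) (norm_nonneg _) ENNReal.toReal_nonneg
    (ENNReal.toReal_pos hIc0 hIc) ENNReal.toReal_nonneg hp0 hs hsp (fun ρ hρ => by
      have h := hscale ρ hρ
      have h1 : ENNReal.ofReal ρ ^ s ≠ ∞ := ENNReal.rpow_ne_top_of_nonneg hs.le (by simp)
      have h2 : ENNReal.ofReal ρ ^ (-((n - s * p) / p)) ≠ ∞ :=
        ENNReal.rpow_ne_top_of_ne_zero (by simpa using hρ) (by simp) 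
      have h3 := ENNReal.toReal_mono (ENNReal.mul_ne_top hCt (ENNReal.add_ne_top.2
        ⟨ENNReal.mul_ne_top h1 hDp, ENNReal.mul_ne_top h2 hIc⟩)) h
      rw [toReal_enorm, ENNReal.toReal_mul, ENNReal.toReal_add (ENNReal.mul_ne_top h1 hDp)
        (ENNReal.mul_ne_top h2 hIc), ENNReal.toReal_mul, ENNReal.toReal_mul,
        ← ENNReal.toReal_rpow, ← ENNReal.toReal_rpow (ENNReal.ofReal ρ),
        ENNReal.toReal_ofReal hρ.le] at h3
      exact h3)
  rw [← hcr] at hreal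
  have hfin := ENNReal.ofReal_le_ofReal hreal
  rw [← ENNReal.ofReal_rpow_of_nonneg (norm_nonneg _) hc0.le, ofReal_norm] at hfin
  refine hfin.trans (le_of_eq ?_)
  rw [ENNReal.ofReal_mul (by positivity), ENNReal.ofReal_mul (by positivity),
    ← ENNReal.ofReal_rpow_of_nonneg (by positivity) hc0.le,
    ← ENNReal.ofReal_rpow_of_nonneg (by positivity) (by positivity),
    ← ENNReal.ofReal_rpow_of_nonneg (by positivity) (by positivity),
    ENNReal.ofReal_toReal hIc, ENNReal.ofReal_toReal hDp, ENNReal.ofReal_mul zero_le_two,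
    ENNReal.ofReal_toReal hCt, ENNReal.ofReal_ofNat, ← ENNReal.rpow_mul, ← ENNReal.rpow_mul,
    one_div_mul_cancel hp0.ne', ENNReal.rpow_one, sobolevConst]
  congr 3
  rw [hcr]
  have : (n : ℝ) - p * s ≠ 0 := by rw [mul_comm]; exact hns.ne'
  field_simp

/-- The fractional Sobolev inequality. -/
theorem lintegral_enorm_rpow_critExp_le (hp : 1 ≤ p) (hs : 0 < s) (hsp : s * p < n)
    (hu : Continuous u) (hc : HasCompactSupport u) :
    ∫⁻ x, ‖u x‖ₑ ^ critExp n s p ≤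
      (sobolevConst n s p * gagliardo s p u ^ p) ^ (n / (n - s * p)) := by
  have hp0 : 0 < p := by linarith
  have hsp0 : 0 < s * p := by positivity
  have hns : 0 < (n : ℝ) - s * p := by linarith
  have hn : 0 < (n : ℝ) := by linarith
  have hc0 : 0 < critExp n s p := hp0.trans_le (le_critExp hp0 hs hsp)
  by_cases hI : ∫⁻ x, ‖u x‖ₑ ^ critExp n s p = 0
  · simp [hI]
  have hIt := (lintegral_enorm_rpow_lt_top hu hc hc0).ne
  have h := lintegral_mono (μ := volume) (enorm_rpow_critExp_le hp hs hsp hu hc hI)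
  rw [lintegral_const_mul _ (measurable_gagliardoDensity hu),
    lintegral_gagliardoDensity hp0 hu] at h
  set I := ∫⁻ x, ‖u x‖ₑ ^ critExp n s p
  -- Integration gave `I ≤ C I^{sp/n} [u]^p`. Dividing by `I^{sp/n}` requires `0 < I < ∞`;
  -- finiteness comes from the compact support.
  have h' : I ^ ((n - s * p) / n) ≤ sobolevConst n s p * gagliardo s p u ^ p := by
    have hI1 : I ^ (s * p / n) ≠ 0 := by simp [ENNReal.rpow_eq_zero_iff, hI, hIt]
    have hI2 : I ^ (s * p / n) ≠ ∞ := ENNReal.rpow_ne_top_of_nonneg (by positivity) hIt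
    rw [show ((n : ℝ) - s * p) / n = 1 - s * p / n by field_simp, ENNReal.rpow_sub _ _ hI hIt,
      ENNReal.rpow_one]
    refine ENNReal.div_le_of_le_mul (h.trans (le_of_eq ?_))
    ring
  calc I = (I ^ ((n - s * p) / n)) ^ (n / (n - s * p)) := by
        rw [← ENNReal.rpow_mul, show ((n : ℝ) - s * p) / n * (n / (n - s * p)) = 1 by field_simp,
          ENNReal.rpow_one]
    _ ≤ _ := by gcongr

end Sobolev

/-! ### Elementary inequalities of Young and interpolation type -/

section Elementary

theorem exists_pos_mul_ofReal_rpow_le {C ε : ℝ≥0∞} (hC : C ≠ ∞) (hε : 0 < ε) {a : ℝ} (ha : 0 < a) :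
    ∃ d : ℝ, 0 < d ∧ C * ENNReal.ofReal d ^ a ≤ ε := by
  have h1 : Filter.Tendsto (fun x : ℝ≥0∞ => x ^ a) (nhds 0) (nhds 0) :=
    (ENNReal.continuous_rpow_const (y := a)).tendsto' 0 0 (ENNReal.zero_rpow_of_pos ha)
  have h2 : Filter.Tendsto (fun d : ℝ => ENNReal.ofReal d) (nhdsWithin 0 (Set.Ioi 0)) (nhds 0) :=
    (ENNReal.continuous_ofReal.tendsto' 0 0 (by simp)).mono_left nhdsWithin_le_nhds
  have h3 := ENNReal.Tendsto.const_mul (h1.comp h2) (Or.inr hC)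
  rw [mul_zero] at h3
  obtain ⟨d, hd1, hd2⟩ := ((h3.eventually (ge_mem_nhds hε)).and self_mem_nhdsWithin).exists
  exact ⟨d, hd2, hd1⟩

theorem exists_pos_mul_le {C ε : ℝ≥0∞} (hC : C ≠ ∞) (hε : 0 < ε) :
    ∃ d : ℝ, 0 < d ∧ C * ENNReal.ofReal d ≤ ε := by
  simpa using exists_pos_mul_ofReal_rpow_le hC hε one_pos

/-- If `l a^{q-r} ≥ 1`, then `a^r` is absorbed by `l a^q`; otherwise `a` is bounded, and so is
`a^{r-p}`. -/
theorem exists_rpow_le_add {p q r l : ℝ} (hp : 0 < p) (hpr : p ≤ r) (hrq : r < q) (hl : 0 < l) :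
    ∃ C : ℝ≥0∞, C ≠ ∞ ∧ ∀ a : ℝ≥0∞, a ^ r ≤ C * a ^ p + ENNReal.ofReal l * a ^ q := by
  have hqr : 0 < q - r := by linarith
  have hl0 : ENNReal.ofReal l ≠ 0 := by simpa using hl
  refine ⟨(ENNReal.ofReal l)⁻¹ ^ ((r - p) / (q - r)),
    ENNReal.rpow_ne_top_of_nonneg (div_nonneg (by linarith) hqr.le) (by simpa using hl), fun a => ?_⟩
  rcases le_total 1 (ENNReal.ofReal l * a ^ (q - r)) with h | h
  · refine le_trans ?_ le_add_self
    calc a ^ r = 1 * a ^ r := (one_mul _).symm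
      _ ≤ ENNReal.ofReal l * a ^ (q - r) * a ^ r := by gcongr
      _ = ENNReal.ofReal l * a ^ q := by
        rw [mul_assoc, ← ENNReal.rpow_add_of_nonneg _ _ hqr.le (by linarith), sub_add_cancel]
  · refine le_trans ?_ le_self_add
    have h1 : a ^ (q - r) ≤ (ENNReal.ofReal l)⁻¹ := by
      rw [← one_div, ENNReal.le_div_iff_mul_le (Or.inl hl0) (Or.inl ENNReal.ofReal_ne_top), mul_comm]
      exact h
    calc a ^ r = (a ^ (q - r)) ^ ((r - p) / (q - r)) * a ^ p := by
          rw [← ENNReal.rpow_mul, mul_div_cancel₀ _ hqr.ne',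
            ← ENNReal.rpow_add_of_nonneg _ _ (by linarith) hp.le, sub_add_cancel]
      _ ≤ _ := by gcongr

/-- Young's inequality with a free small parameter, proved by comparing `k` with `l a^{q-r}`. -/
theorem exists_mul_rpow_le_add {q r l : ℝ} (hr : 0 < r) (hrq : r < q) (hl : 0 < l) :
    ∃ C : ℝ≥0∞, C ≠ ∞ ∧ ∀ a k : ℝ≥0∞,
      k * a ^ r ≤ C * k ^ (q / (q - r)) + ENNReal.ofReal l * a ^ q := by
  have hqr : 0 < q - r := by linarith
  have hl0 : ENNReal.ofReal l ≠ 0 := by simpa using hl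
  refine ⟨(ENNReal.ofReal l)⁻¹ ^ (r / (q - r)),
    ENNReal.rpow_ne_top_of_nonneg (by positivity) (by simpa using hl), fun a k => ?_⟩
  rcases le_total k (ENNReal.ofReal l * a ^ (q - r)) with h | h
  · refine le_trans ?_ le_add_self
    calc k * a ^ r ≤ ENNReal.ofReal l * a ^ (q - r) * a ^ r := by gcongr
      _ = ENNReal.ofReal l * a ^ q := by
        rw [mul_assoc, ← ENNReal.rpow_add_of_nonneg _ _ hqr.le (by linarith), sub_add_cancel]
  · refine le_trans ?_ le_self_add
    have h1 : a ^ (q - r) ≤ (ENNReal.ofReal l)⁻¹ * k := by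
      rw [mul_comm, ← div_eq_mul_inv,
        ENNReal.le_div_iff_mul_le (Or.inl hl0) (Or.inl ENNReal.ofReal_ne_top), mul_comm]
      exact h
    calc k * a ^ r = k * (a ^ (q - r)) ^ (r / (q - r)) := by
          rw [← ENNReal.rpow_mul, mul_div_cancel₀ _ hqr.ne']
      _ ≤ k * ((ENNReal.ofReal l)⁻¹ * k) ^ (r / (q - r)) := by gcongr
      _ = (ENNReal.ofReal l)⁻¹ ^ (r / (q - r)) * (k ^ (1 : ℝ) * k ^ (r / (q - r))) := by
          rw [ENNReal.mul_rpow_of_nonneg _ _ (by positivity), ENNReal.rpow_one]; ring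
      _ = _ := by
          rw [← ENNReal.rpow_add_of_nonneg _ _ zero_le_one (by positivity),
            show 1 + r / (q - r) = q / (q - r) by field_simp; ring]

/-- The exponent `τ` is the one with `r = (1-τ)e + τq`, so `k a^r = (k v^{-τ}) (a^e)^{1-τ} (a^q
v)^τ`, and each of the last two bases is at most their sum. -/
theorem ofReal_mul_rpow_le_of_ratio_le {c q r e k v : ℝ} (he : 0 < e) (her : e ≤ r) (hrq : r < q)
    (hv : 0 < v) (h : k * v ^ (-((r - e) / (q - e))) ≤ c) (a : ℝ≥0∞) :
    ENNReal.ofReal k * a ^ r ≤ ENNReal.ofReal c * (a ^ e + a ^ q * ENNReal.ofReal v) := by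
  have hqe : 0 < q - e := by linarith
  set τ := (r - e) / (q - e) with hτ
  have hτ0 : 0 ≤ τ := div_nonneg (by linarith) hqe.le
  have hτ1 : 0 ≤ 1 - τ := by rw [hτ, sub_nonneg, div_le_one hqe]; linarith
  have hr : r = e * (1 - τ) + q * τ := by rw [hτ]; field_simp; ring
  have hk : ENNReal.ofReal k = ENNReal.ofReal (k * v ^ (-τ)) * ENNReal.ofReal v ^ τ := by
    rw [ENNReal.ofReal_rpow_of_pos hv, ← ENNReal.ofReal_mul' (by positivity), mul_assoc,
      ← Real.rpow_add hv, neg_add_cancel, Real.rpow_zero, mul_one]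
  calc ENNReal.ofReal k * a ^ r
      = ENNReal.ofReal (k * v ^ (-τ)) *
          ((a ^ e) ^ (1 - τ) * (a ^ q * ENNReal.ofReal v) ^ τ) := by
        rw [ENNReal.mul_rpow_of_nonneg _ _ hτ0, ← ENNReal.rpow_mul, ← ENNReal.rpow_mul, hk,
          show a ^ r = a ^ (e * (1 - τ)) * a ^ (q * τ) by
            rw [← ENNReal.rpow_add_of_nonneg _ _ (by positivity)
              (mul_nonneg (by linarith) hτ0), ← hr]]
        ring
    _ ≤ ENNReal.ofReal c * ((a ^ e + a ^ q * ENNReal.ofReal v) ^ (1 - τ) *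
          (a ^ e + a ^ q * ENNReal.ofReal v) ^ τ) := by
        gcongr
        · exact le_self_add
        · exact le_add_self
    _ = _ := by
        rw [← ENNReal.rpow_add_of_nonneg _ _ hτ1 hτ0, sub_add_cancel, ENNReal.rpow_one]

end Elementary

/-! ### Local smallness in `L^p` from finitely many means -/

section Local

variable {n : ℕ} {s p : ℝ}

/-- Apply the pointwise inequality at each `x` in a ball of the cover that contains it, then
convexity of the `p`-th power. The seminorm term carries `d^{sp}`, which is small before the means
are considered. -/
theorem setLIntegral_ball_enorm_rpow_le (hp : 1 ≤ p) (hs : 0 < s) {u : Rn n → ℝ}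
    (hu : Continuous u) {S : Set (Rn n)} (hS : MeasurableSet S) {t : Set (Rn n)} {d : ℝ}
    (ht : S ⊆ ⋃ z ∈ t, Metric.ball z d) {η : ℝ≥0∞}
    (hη : ∀ z ∈ t, (volume (Metric.ball z d))⁻¹ * ‖∫ y in Metric.ball z d, u y‖ₑ ≤ η) :
    ∫⁻ x in S, ‖u x‖ₑ ^ p ≤ 2 ^ (p - 1) * ((ballConst n s p * ENNReal.ofReal d ^ s) ^ p *
      gagliardo s p u ^ p + η ^ p * volume S) := by
  have hp0 : 0 < p := by linarith
  calc ∫⁻ x in S, ‖u x‖ₑ ^ p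
      ≤ ∫⁻ x in S, 2 ^ (p - 1) * ((ballConst n s p * ENNReal.ofReal d ^ s) ^ p *
          gagliardoDensity s p u x + η ^ p) := by
        refine setLIntegral_mono' hS fun x hx => ?_
        obtain ⟨z, hz, hxz⟩ := Set.mem_iUnion₂.1 (ht hx)
        calc ‖u x‖ₑ ^ p ≤ (ballConst n s p * ENNReal.ofReal d ^ s *
              gagliardoDensity s p u x ^ (1 / p) + η) ^ p := by
              gcongr
              exact (enorm_le_of_mem_ball hp hs hu hxz).trans (by gcongr; exact hη z hz)
          _ ≤ 2 ^ (p - 1) * ((ballConst n s p * ENNReal.ofReal d ^ s *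
              gagliardoDensity s p u x ^ (1 / p)) ^ p + η ^ p) :=
              ENNReal.rpow_add_le_mul_rpow_add_rpow _ _ hp
          _ = _ := by
              rw [ENNReal.mul_rpow_of_nonneg _ _ hp0.le, ← ENNReal.rpow_mul,
                one_div_mul_cancel hp0.ne', ENNReal.rpow_one]
    _ = 2 ^ (p - 1) * ((ballConst n s p * ENNReal.ofReal d ^ s) ^ p *
          (∫⁻ x in S, gagliardoDensity s p u x) + η ^ p * volume S) := by
        have hm := measurable_gagliardoDensity (s := s) (p := p) hu
        rw [lintegral_const_mul _ (by fun_prop), lintegral_add_right _ (by fun_prop),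
          lintegral_const_mul _ hm, setLIntegral_const]
    _ ≤ _ := by
        gcongr
        rw [← lintegral_gagliardoDensity hp0 hu]
        exact setLIntegral_le_lintegral _ _

/-- Functions with bounded Gagliardo seminorm and small means over finitely many balls are small
in `L^p` of a bounded set. -/
theorem exists_finset_setLIntegral_ball_le (hp : 1 ≤ p) (hs : 0 < s) (R : ℝ) {ε : ℝ≥0∞}
    (hε : 0 < ε) : ∃ (t : Finset (Rn n)) (d η : ℝ), 0 < η ∧ ∀ u : Rn n → ℝ, Continuous u →
      gagliardo s p u ≤ 1 → (∀ z ∈ t, ‖∫ y in Metric.ball z d, u y‖ ≤ η) →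
      ∫⁻ x in Metric.ball (0 : Rn n) R, ‖u x‖ₑ ^ p ≤ ε := by
  have hp0 : 0 < p := by linarith
  have hε2 : 0 < ε / 2 := ENNReal.div_pos hε.ne' (by simp)
  have h2 : (2 : ℝ≥0∞) ^ (p - 1) ≠ ∞ := ENNReal.rpow_ne_top_of_nonneg (by linarith) (by simp)
  obtain ⟨d, hd, hdε⟩ := exists_pos_mul_ofReal_rpow_le (C := 2 ^ (p - 1) * ballConst n s p ^ p)
    (ENNReal.mul_ne_top h2 (ENNReal.rpow_ne_top_of_nonneg hp0.le (ballConst_ne_top hp0 hs))) hε2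
    (a := s * p) (by positivity)
  set v := volume (Metric.ball (0 : Rn n) d) with hv
  have hv0 : v ≠ 0 := (Metric.measure_ball_pos volume _ hd).ne'
  obtain ⟨η, hη, hηε⟩ := exists_pos_mul_ofReal_rpow_le
    (C := 2 ^ (p - 1) * (v⁻¹ ^ p * volume (Metric.ball (0 : Rn n) R)))
    (ENNReal.mul_ne_top h2 (ENNReal.mul_ne_top
      (ENNReal.rpow_ne_top_of_nonneg hp0.le (by simpa using hv0)) measure_ball_lt_top.ne)) hε2 hp0
  obtain ⟨t, htf, ht⟩ := Metric.totallyBounded_iff.1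
    ((isCompact_closedBall (0 : Rn n) R).totallyBounded.subset Metric.ball_subset_closedBall) d hd
  refine ⟨htf.toFinset, d, η, hη, fun u hu hG hm => ?_⟩
  refine (setLIntegral_ball_enorm_rpow_le hp hs hu measurableSet_ball ht
    (η := v⁻¹ * ENNReal.ofReal η) fun z hz => ?_).trans ?_
  · rw [show volume (Metric.ball z d) = v by rw [hv, volume_ball_eq z hd, volume_ball_eq 0 hd],
      ← ofReal_norm]
    gcongr
    exact hm z (htf.mem_toFinset.2 hz)
  · rw [mul_add, ← ENNReal.add_halves ε, ENNReal.mul_rpow_of_nonneg _ _ hp0.le,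
      ENNReal.mul_rpow_of_nonneg _ _ hp0.le, ← ENNReal.rpow_mul]
    refine add_le_add (le_trans ?_ hdε) (le_trans (le_of_eq ?_) hηε)
    · calc _ ≤ 2 ^ (p - 1) * (ballConst n s p ^ p * ENNReal.ofReal d ^ (s * p) * 1) := by
            gcongr
            exact ENNReal.rpow_le_one hG hp0.le
        _ = _ := by ring
    · ring

end Local

/-! ### Smallness in `L^r(K)` from finitely many means -/

section Weighted

variable {n : ℕ} {s p q r V₀ : ℝ} {K V u : Rn n → ℝ}

theorem lintegral_weighted (hK : AEMeasurable K volume) (hu : Continuous u) {a : ℝ} :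
    ∫⁻ x, ‖u x‖ₑ ^ a ∂(weighted K) = ∫⁻ x, ENNReal.ofReal (K x) * ‖u x‖ₑ ^ a := by
  have hm := hu.measurable
  exact lintegral_withDensity_eq_lintegral_mul₀ hK.ennreal_ofReal (by fun_prop)

theorem weightedNorm_le_mNorm : weightedNorm V q u ≤ mNorm s q p V u := le_self_add

theorem gagliardo_le_mNorm : gagliardo s p u ≤ mNorm s q p V u := le_add_self

theorem lintegral_weighted_eq_weightedNorm_rpow (hq : 0 < q) :
    ∫⁻ x, ‖u x‖ₑ ^ q ∂(weighted V) = weightedNorm V q u ^ q := by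
  rw [weightedNorm, ← ENNReal.rpow_mul, one_div_mul_cancel hq.ne', ENNReal.rpow_one]

theorem lintegral_enorm_rpow_le_of_le (hV₀ : 0 < V₀) (hV : ∀ x, V₀ ≤ V x)
    (hVm : AEMeasurable V volume) (hu : Continuous u) (hq : 0 < q) :
    ∫⁻ x, ‖u x‖ₑ ^ q ≤ (ENNReal.ofReal V₀)⁻¹ * weightedNorm V q u ^ q := by
  have h0 : ENNReal.ofReal V₀ ≠ 0 := by simpa using hV₀
  rw [← lintegral_weighted_eq_weightedNorm_rpow hq, lintegral_weighted hVm hu,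
    mul_comm, ← div_eq_mul_inv, ENNReal.le_div_iff_mul_le (Or.inl h0) (Or.inl (by simp)), mul_comm,
    ← lintegral_const_mul' _ _ (by simp)]
  exact lintegral_mono fun x => by gcongr; exact hV x

theorem aemeasurable_of_forall_memLp {t : ℝ≥0∞}
    (hK : ∀ Ω : Set (Rn n), MeasurableSet Ω → volume Ω < ∞ → MemLp K t (volume.restrict Ω)) :
    AEMeasurable K volume := by
  have h : AEMeasurable K (volume.restrict (⋃ m : ℕ, Metric.ball (0 : Rn n) m)) :=
    aemeasurable_iUnion_iff.2 fun m =>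
      (hK _ measurableSet_ball measure_ball_lt_top).aestronglyMeasurable.aemeasurable
  rwa [Metric.iUnion_ball_nat, Measure.restrict_univ] at h

/-- The integral of an integrable function over the complement of the set where `|x| < m` and
`f(x) ≤ m` tends to `0`. -/
theorem exists_nat_setLIntegral_compl_le {f : Rn n → ℝ} (hf : Measurable f) {E : Set (Rn n)}
    (hE : volume E ≠ ∞) {g : Rn n → ℝ≥0∞} (hg : ∫⁻ x in E, g x ≠ ∞) {ε : ℝ≥0∞} (hε : 0 < ε) :
    ∃ m : ℕ, ∫⁻ x in (Metric.ball (0 : Rn n) m ∩ {x | f x ≤ m})ᶜ, g x ∂(volume.restrict E) ≤ ε := by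
  set S : ℕ → Set (Rn n) := fun m => (Metric.ball (0 : Rn n) m ∩ {x | f x ≤ m})ᶜ with hS
  have hmeas : ∀ m, MeasurableSet (S m) := fun m =>
    (measurableSet_ball.inter (measurableSet_le hf measurable_const)).compl
  have hanti : Antitone S := fun a b hab => Set.compl_subset_compl.2 <|
    Set.inter_subset_inter (Metric.ball_subset_ball (by exact_mod_cast hab))
      fun x (hx : f x ≤ a) => hx.trans (by exact_mod_cast hab)
  have hempty : ⋂ m, S m = ∅ := by
    refine Set.eq_empty_of_forall_notMem fun x hx => ?_
    obtain ⟨m, hm⟩ := exists_nat_gt (max ‖x‖ (f x))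
    refine Set.mem_iInter.1 hx m ⟨?_, ((le_max_right _ _).trans_lt hm).le⟩
    simpa using (le_max_left _ _).trans_lt hm
  -- Continuity from above uses that `E` has finite measure; absolute continuity of the integral of
  -- `g` then finishes.
  have hlim := tendsto_measure_iInter_atTop (μ := volume.restrict E)
    (fun m => (hmeas m).nullMeasurableSet) hanti
    ⟨0, ((measure_mono (Set.subset_univ _)).trans_lt (by simpa using hE.lt_top)).ne⟩
  rw [hempty, measure_empty] at hlim
  exact ((tendsto_setLIntegral_zero hg hlim).eventually (ge_mem_nhds hε)).exists

theorem setLIntegral_ofReal_rpow_lt_top {t : ℝ≥0∞} {a : ℝ} (ha : 0 < a)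
    (hat : ENNReal.ofReal a ≤ t) {E : Set (Rn n)} (hE : volume E < ∞)
    (hK : MemLp K t (volume.restrict E)) : ∫⁻ x in E, ENNReal.ofReal (K x) ^ a < ∞ := by
  have : IsFiniteMeasure (volume.restrict E) := ⟨by simpa using hE⟩
  have h := (hK.mono_exponent hat).eLpNorm_lt_top
  rw [eLpNorm_lt_top_iff_lintegral_rpow_enorm_lt_top (by simpa using ha) (by simp),
    ENNReal.toReal_ofReal ha.le] at h
  refine (lintegral_mono fun x => ?_).trans_lt h
  gcongr
  rw [← ofReal_norm]
  exact ENNReal.ofReal_le_ofReal (Real.le_norm_self _)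

/-- Test functions of norm at most `1` with small means over finitely many balls are small in
`L^r(K)`. -/
theorem exists_finset_lintegral_weighted_le (hp : 1 ≤ p) (hs : 0 < s) (hsp : s * p < n)
    (hr : critExp n s p ≤ r) (hrq : r < q) (hVm : AEMeasurable V volume)
    (hV₀ : 0 < V₀) (hV : ∀ x, V₀ ≤ V x) {t : ℝ≥0∞} (ht : ENNReal.ofReal (q / (q - r)) < t)
    (hKt : ∀ Ω : Set (Rn n), MeasurableSet Ω → volume Ω < ∞ → MemLp K t (volume.restrict Ω))
    (hKV : VanishesAtInfinity fun x =>
      K x * V x ^ (-((r - critExp n s p) / (q - critExp n s p))))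
    {ε : ℝ≥0∞} (hε : 0 < ε) :
    ∃ (t : Finset (Rn n)) (d η : ℝ), 0 < η ∧ ∀ u : Rn n → ℝ, Continuous u → HasCompactSupport u →
      mNorm s q p V u ≤ 1 → (∀ z ∈ t, ‖∫ y in Metric.ball z d, u y‖ ≤ η) →
      ∫⁻ x, ‖u x‖ₑ ^ r ∂(weighted K) ≤ ε := by
  have hp0 : 0 < p := by linarith
  have hpc := le_critExp hp0 hs hsp
  set c := critExp n s p with hc
  have hc0 : 0 < c := by linarith
  have hr0 : 0 < r := by linarith
  have hq0 : 0 < q := by linarith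
  have hqr : 0 < q - r := by linarith
  have hns : 0 < (n : ℝ) - s * p := by linarith
  have hVpos : ∀ x, 0 < V x := fun x => hV₀.trans_le (hV x)
  -- `K` is replaced by a measurable representative `k` so that the truncation set `F` below is
  -- measurable.
  have hKm := aemeasurable_of_forall_memLp hKt
  set k := hKm.mk K with hk
  have hkm : Measurable k := hKm.measurable_mk
  have hkK : K =ᵐ[volume] k := hKm.ae_eq_mk
  -- Five error terms: one off `E`, two on `E \ F`, two on `E ∩ F`.
  have hε5 : 0 < ε / 5 := ENNReal.div_pos hε.ne' (by simp)
  set Q : ℝ≥0∞ := (ENNReal.ofReal V₀)⁻¹ with hQ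
  have hQt : Q ≠ ∞ := by simpa [hQ] using hV₀
  set S : ℝ≥0∞ := sobolevConst n s p ^ ((n : ℝ) / (n - s * p)) with hS
  have hSt : S ≠ ∞ :=
    ENNReal.rpow_ne_top_of_nonneg (by positivity) (sobolevConst_ne_top hp hs hsp)
  obtain ⟨c₁, hc₁, hc₁ε⟩ := exists_pos_mul_le (C := S + 1) (by simp [hSt]) hε5
  -- The superlevel set need not be measurable; its measurable hull has the same measure.
  set E := toMeasurable volume {x | c₁ ≤ |K x * V x ^ (-((r - c) / (q - c)))|} with hE
  have hEm : MeasurableSet E := measurableSet_toMeasurable _ _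
  have hEt : volume E < ∞ := by rw [hE, measure_toMeasurable]; exact hKV.2 c₁ hc₁
  have hEc : ∀ x ∉ E, K x * V x ^ (-((r - c) / (q - c))) ≤ c₁ := fun x hx => by
    by_contra hlt
    exact hx (subset_toMeasurable _ _ ((not_le.1 hlt).le.trans (le_abs_self _)))
  obtain ⟨l₁, hl₁, hl₁ε⟩ := exists_pos_mul_le hQt hε5
  obtain ⟨C₁, hC₁t, hC₁⟩ := exists_mul_rpow_le_add hr0 hrq hl₁
  have hgt : ∫⁻ x in E, C₁ * ENNReal.ofReal (K x) ^ (q / (q - r)) ≠ ∞ := by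
    rw [lintegral_const_mul' _ _ hC₁t]
    exact ENNReal.mul_ne_top hC₁t (setLIntegral_ofReal_rpow_lt_top (by positivity) ht.le hEt
      (hKt E hEm hEt)).ne
  obtain ⟨m, hm⟩ := exists_nat_setLIntegral_compl_le hkm hEt.ne hgt hε5
  set F := Metric.ball (0 : Rn n) m ∩ {x | k x ≤ m} with hF
  have hFm : MeasurableSet F := measurableSet_ball.inter (measurableSet_le hkm measurable_const)
  obtain ⟨l₂, hl₂, hl₂ε⟩ := exists_pos_mul_le (C := (m : ℝ≥0∞) * Q)
    (ENNReal.mul_ne_top (by simp) hQt) hε5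
  -- Order of choice: `m` bounds `K` on `F`, `l₂` depends on `m`, `C₂` on `l₂`, and only then is the
  -- required local `L^p` smallness `l₃` fixed.
  obtain ⟨C₂, hC₂t, hC₂⟩ := exists_rpow_le_add hp0 (hpc.trans hr) hrq hl₂
  obtain ⟨l₃, hl₃, hl₃ε⟩ := exists_pos_mul_le (C := (m : ℝ≥0∞) * C₂)
    (ENNReal.mul_ne_top (by simp) hC₂t) hε5
  obtain ⟨T, d, η, hη, hT⟩ := exists_finset_setLIntegral_ball_le (n := n) hp hs m
    (ENNReal.ofReal_pos.2 hl₃)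
  refine ⟨T, d, η, hη, fun u hu hcs hnorm hmean => ?_⟩
  have hum := hu.measurable
  have hG : gagliardo s p u ≤ 1 := gagliardo_le_mNorm.trans hnorm
  have hW : weightedNorm V q u ≤ 1 := weightedNorm_le_mNorm.trans hnorm
  have huc : ∫⁻ x, ‖u x‖ₑ ^ c ≤ S := by
    refine (lintegral_enorm_rpow_critExp_le hp hs hsp hu hcs).trans ?_
    rw [hS]
    gcongr
    exact mul_le_of_le_one_right' (ENNReal.rpow_le_one hG hp0.le)
  have huV : ∫⁻ x, ‖u x‖ₑ ^ q * ENNReal.ofReal (V x) ≤ 1 := by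
    simp_rw [mul_comm]
    rw [← lintegral_weighted hVm hu, lintegral_weighted_eq_weightedNorm_rpow hq0]
    exact ENNReal.rpow_le_one hW hq0.le
  have huq : ∫⁻ x, ‖u x‖ₑ ^ q ≤ Q :=
    (lintegral_enorm_rpow_le_of_le hV₀ hV hVm hu hq0).trans
      (mul_le_of_le_one_right' (ENNReal.rpow_le_one hW hq0.le))
  rw [lintegral_weighted hKm hu, ← lintegral_add_compl _ hEm,
    ← lintegral_add_compl (μ := volume.restrict E) _ hFm]
  have h1 : ∫⁻ x in Eᶜ, ENNReal.ofReal (K x) * ‖u x‖ₑ ^ r ≤ ε / 5 := by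
    calc ∫⁻ x in Eᶜ, ENNReal.ofReal (K x) * ‖u x‖ₑ ^ r
        ≤ ∫⁻ x in Eᶜ, ENNReal.ofReal c₁ * (‖u x‖ₑ ^ c + ‖u x‖ₑ ^ q * ENNReal.ofReal (V x)) :=
          setLIntegral_mono' hEm.compl fun x hx =>
            ofReal_mul_rpow_le_of_ratio_le hc0 hr hrq (hVpos x) (hEc x hx) _
      _ ≤ ∫⁻ x, ENNReal.ofReal c₁ * (‖u x‖ₑ ^ c + ‖u x‖ₑ ^ q * ENNReal.ofReal (V x)) :=
          setLIntegral_le_lintegral _ _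
      _ = ENNReal.ofReal c₁ *
            ((∫⁻ x, ‖u x‖ₑ ^ c) + ∫⁻ x, ‖u x‖ₑ ^ q * ENNReal.ofReal (V x)) := by
          rw [lintegral_const_mul' _ _ (by simp), lintegral_add_left (by fun_prop)]
      _ ≤ ENNReal.ofReal c₁ * (S + 1) := by gcongr
      _ ≤ ε / 5 := by rwa [mul_comm]
  have h2 : ∫⁻ x in Fᶜ, ENNReal.ofReal (K x) * ‖u x‖ₑ ^ r ∂(volume.restrict E) ≤
      ε / 5 + ε / 5 := by
    calc ∫⁻ x in Fᶜ, ENNReal.ofReal (K x) * ‖u x‖ₑ ^ r ∂(volume.restrict E)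
        ≤ ∫⁻ x in Fᶜ, (C₁ * ENNReal.ofReal (K x) ^ (q / (q - r)) +
            ENNReal.ofReal l₁ * ‖u x‖ₑ ^ q) ∂(volume.restrict E) :=
          lintegral_mono fun x => hC₁ _ _
      _ = (∫⁻ x in Fᶜ, C₁ * ENNReal.ofReal (K x) ^ (q / (q - r)) ∂(volume.restrict E)) +
            ENNReal.ofReal l₁ * ∫⁻ x in Fᶜ, ‖u x‖ₑ ^ q ∂(volume.restrict E) := by
          rw [lintegral_add_right _ (by fun_prop),
            lintegral_const_mul' (ENNReal.ofReal l₁) _ (by simp)]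
      _ ≤ ε / 5 + ENNReal.ofReal l₁ * Q := by
          gcongr
          exact (setLIntegral_le_lintegral _ _).trans ((setLIntegral_le_lintegral _ _).trans huq)
      _ ≤ ε / 5 + ε / 5 := by gcongr; rwa [mul_comm]
  have h3 : ∫⁻ x in F, ENNReal.ofReal (K x) * ‖u x‖ₑ ^ r ∂(volume.restrict E) ≤
      ε / 5 + ε / 5 := by
    calc ∫⁻ x in F, ENNReal.ofReal (K x) * ‖u x‖ₑ ^ r ∂(volume.restrict E)
        ≤ ∫⁻ x in F, ENNReal.ofReal (K x) * ‖u x‖ₑ ^ r :=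
          lintegral_mono' (Measure.restrict_mono_measure Measure.restrict_le_self _) le_rfl
      _ ≤ ∫⁻ x in F, m * (C₂ * ‖u x‖ₑ ^ p + ENNReal.ofReal l₂ * ‖u x‖ₑ ^ q) := by
          refine setLIntegral_mono_ae' hFm (hkK.mono fun x hx hxF => ?_)
          refine mul_le_mul' ?_ (hC₂ _)
          rw [hx, ← ENNReal.ofReal_natCast]
          exact ENNReal.ofReal_le_ofReal hxF.2
      _ = m * C₂ * (∫⁻ x in F, ‖u x‖ₑ ^ p) + m * ENNReal.ofReal l₂ * ∫⁻ x in F, ‖u x‖ₑ ^ q := by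
          rw [lintegral_const_mul' _ _ (by simp), lintegral_add_left (by fun_prop),
            lintegral_const_mul' _ _ hC₂t, lintegral_const_mul' _ _ (by simp)]
          ring
      _ ≤ m * C₂ * ENNReal.ofReal l₃ + m * ENNReal.ofReal l₂ * Q := by
          gcongr
          · exact (lintegral_mono_set Set.inter_subset_left).trans (hT u hu hG hmean)
          · exact (setLIntegral_le_lintegral _ _).trans huq
      _ ≤ ε / 5 + ε / 5 := by
          refine add_le_add hl₃ε (le_trans (le_of_eq ?_) hl₂ε)
          ring
  calc _ ≤ (ε / 5 + ε / 5) + (ε / 5 + ε / 5) + ε / 5 := add_le_add (add_le_add h3 h2) h1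
    _ = 5 * (ε / 5) := by ring
    _ = ε := ENNReal.mul_div_cancel (by simp) (by simp)

end Weighted

/-! ### Compact extension of finitely controlled operators -/

section Extension

variable {X Y : Type*} [SeminormedAddCommGroup X] [NormedSpace ℝ X] [NormedAddCommGroup Y]
  [NormedSpace ℝ Y]

/-- `T` is small on the vectors of the unit ball at which finitely many continuous functionals,
depending on the required smallness, are small. -/
def IsFinitelyControlled (T : X →ₗ[ℝ] Y) : Prop :=
  ∀ ε : ℝ, 0 < ε → ∃ (ι : Type) (_ : Fintype ι) (P : X →L[ℝ] (ι → ℝ)),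
    ∀ x, ‖x‖ ≤ 1 → ‖P x‖ ≤ 1 → ‖T x‖ ≤ ε

theorem IsFinitelyControlled.continuous {T : X →ₗ[ℝ] Y} (h : IsFinitelyControlled T) :
    Continuous T := by
  refine continuous_of_continuousAt_zero T ?_
  rw [Metric.continuousAt_iff]
  intro ε hε
  obtain ⟨ι, _, P, hP⟩ := h (ε / 2) (by positivity)
  -- Within this radius both `‖x‖ ≤ 1` and `‖P x‖ ≤ 1` hold.
  refine ⟨(1 + ‖P‖)⁻¹, by positivity, fun {x} hx => ?_⟩
  rw [dist_zero_right] at hx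
  rw [map_zero, dist_zero_right]
  have h1 : (1 + ‖P‖) * ‖x‖ ≤ 1 := by
    have := (mul_lt_mul_of_pos_left hx (show 0 < 1 + ‖P‖ by positivity)).le
    rwa [mul_inv_cancel₀ (by positivity)] at this
  have h2 : 0 ≤ ‖P‖ * ‖x‖ := by positivity
  have h3 := norm_nonneg x
  have := hP x (by linarith) ((P.le_opNorm x).trans (by linarith))
  linarith

/-- The image of the unit ball under `P` is bounded in a finite-dimensional space, hence totally
bounded, and `T` transfers a finite net of it to a finite net of its own image. -/
theorem IsFinitelyControlled.totallyBounded {T : X →ₗ[ℝ] Y} (h : IsFinitelyControlled T) :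
    TotallyBounded (T '' Metric.closedBall 0 1) := by
  rw [Metric.totallyBounded_iff]
  intro ε hε
  obtain ⟨ι, _, P, hP⟩ := h (ε / 4) (by positivity)
  have hb : TotallyBounded (P '' Metric.closedBall 0 1) := by
    have hbd : Bornology.IsBounded (P '' Metric.closedBall 0 1) :=
      P.lipschitz.isBounded_image Metric.isBounded_closedBall
    exact (hbd.isCompact_closure.totallyBounded).subset subset_closure
  obtain ⟨t, hts, htf, ht⟩ := Set.exists_subset_image_finite_and.1
    (hb.exists_subset (Metric.dist_mem_uniformity zero_lt_two))
  refine ⟨T '' t, htf.image _, ?_⟩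
  rintro _ ⟨x, hx, rfl⟩
  obtain ⟨_, ⟨y, hy, rfl⟩, hxy⟩ := Set.mem_iUnion₂.1 (ht ⟨x, hx, rfl⟩)
  refine Set.mem_iUnion₂.2 ⟨T y, ⟨y, hy, rfl⟩, ?_⟩
  have hx1 := mem_closedBall_zero_iff.1 hx
  have hy1 := mem_closedBall_zero_iff.1 (hts hy)
  have hd : ‖P x - P y‖ < 2 := by simpa [dist_eq_norm] using hxy
  -- Half the difference of two unit vectors lies in the unit ball, and its image under `P` has norm
  -- below `1`, the net having mesh `2`; hence `‖T x - T y‖ ≤ ε / 2`.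
  have key := hP ((2 : ℝ)⁻¹ • (x - y))
    (by rw [norm_smul]; norm_num; linarith [norm_sub_le x y])
    (by rw [map_smul, map_sub, norm_smul]; norm_num; linarith)
  rw [map_smul, map_sub, norm_smul] at key
  norm_num at key
  rw [Metric.mem_ball, dist_eq_norm]
  linarith

theorem IsFinitelyControlled.exists_isCompactOperator [CompleteSpace Y] {T : X →ₗ[ℝ] Y}
    (h : IsFinitelyControlled T) :
    ∃ ι : UniformSpace.Completion X →L[ℝ] Y,
      (∀ x : X, ι (x : UniformSpace.Completion X) = T x) ∧ IsCompactOperator ι := by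
  set T' : X →L[ℝ] Y := ⟨T, h.continuous⟩ with hT'
  have hdense : DenseRange (UniformSpace.Completion.toComplL : X →L[ℝ] _) :=
    UniformSpace.Completion.denseRange_coe
  set f := T'.extend (UniformSpace.Completion.toComplL : X →L[ℝ] UniformSpace.Completion X) with hf
  have hfT : ∀ x : X, f (x : UniformSpace.Completion X) = T x := fun x =>
    T'.extend_eq hdense (UniformSpace.Completion.isUniformInducing_coe X) x
  refine ⟨f, hfT, closure (T '' Metric.closedBall 0 1),
    h.totallyBounded.closure.isCompact_of_isClosed isClosed_closure,
    Filter.mem_of_superset (Metric.ball_mem_nhds 0 one_pos) fun y hy => ?_⟩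
  -- The open unit ball of the completion lies in the closure of the vectors of `X` inside it, so
  -- its image lies in the compact closure.
  have hy' := (UniformSpace.Completion.denseRange_coe (α := X)).open_subset_closure_inter
    Metric.isOpen_ball hy
  refine closure_mono ?_ (image_closure_subset_closure_image f.continuous ⟨y, hy', rfl⟩)
  rintro _ ⟨_, ⟨hx, x, rfl⟩, rfl⟩
  refine ⟨x, ?_, (hfT x).symm⟩
  rw [mem_ball_zero_iff, UniformSpace.Completion.norm_coe] at hx
  exact mem_closedBall_zero_iff.2 hx.le

end Extension

/-! ### Ball integrals as continuous functionals on test functions -/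

section Embedding

variable {n : ℕ} {s p q r V₀ : ℝ} {K V : Rn n → ℝ} [hq : Fact (1 ≤ q)] [hp : Fact (1 ≤ p)]

namespace TestSpace

theorem continuous_toFun (u : TestSpace n s q p V) : Continuous u.toFun := u.2.1.continuous

theorem hasCompactSupport_toFun (u : TestSpace n s q p V) : HasCompactSupport u.toFun := u.2.2.1

theorem mNorm_ne_top (u : TestSpace n s q p V) : mNorm s q p V u.toFun ≠ ∞ := u.2.2.2.ne

theorem ofReal_norm_eq (u : TestSpace n s q p V) :
    ENNReal.ofReal ‖u‖ = mNorm s q p V u.toFun := ENNReal.ofReal_toReal u.mNorm_ne_top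

theorem mNorm_le_ofReal {u : TestSpace n s q p V} {c : ℝ} (h : ‖u‖ ≤ c) :
    mNorm s q p V u.toFun ≤ ENNReal.ofReal c := by
  rw [← ofReal_norm_eq]; exact ENNReal.ofReal_le_ofReal h

theorem integrableOn_toFun (u : TestSpace n s q p V) (B : Set (Rn n)) :
    IntegrableOn u.toFun B :=
  (u.continuous_toFun.integrable_of_hasCompactSupport u.hasCompactSupport_toFun).integrableOn

/-- Since `V ≥ V₀ > 0`, the norm dominates the unweighted `L^q` norm, and Hölder on the ball bounds
the integral. -/
theorem exists_clm_setIntegral_ball (hVm : AEMeasurable V volume) (hV₀ : 0 < V₀)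
    (hV : ∀ x, V₀ ≤ V x) (z : Rn n) (d : ℝ) :
    ∃ L : TestSpace n s q p V →L[ℝ] ℝ, ∀ u, L u = ∫ y in Metric.ball z d, u.toFun y := by
  have hq0 : 0 < q := by linarith [hq.out]
  set L : TestSpace n s q p V →ₗ[ℝ] ℝ :=
    { toFun := fun u => ∫ y in Metric.ball z d, u.toFun y
      map_add' := fun u v => integral_add (u.integrableOn_toFun _) (v.integrableOn_toFun _)
      map_smul' := fun c u => integral_const_mul c u.toFun } with hL
  set C : ℝ≥0∞ := ((ENNReal.ofReal V₀)⁻¹) ^ (1 / q) *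
    volume (Metric.ball z d) ^ (1 - 1 / q) with hC
  have hq1 : 0 ≤ 1 - 1 / q := by
    rw [sub_nonneg, div_le_one hq0]; exact hq.out
  have hCt : C ≠ ∞ := ENNReal.mul_ne_top
    (ENNReal.rpow_ne_top_of_nonneg (by positivity) (by simpa using hV₀))
    (ENNReal.rpow_ne_top_of_nonneg hq1 measure_ball_lt_top.ne)
  refine ⟨L.mkContinuous C.toReal fun u => ?_, fun u => rfl⟩
  have hmain : ‖∫ y in Metric.ball z d, u.toFun y‖ₑ ≤ C * mNorm s q p V u.toFun := by
    calc ‖∫ y in Metric.ball z d, u.toFun y‖ₑ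
        ≤ ∫⁻ y in Metric.ball z d, ‖u.toFun y‖ₑ := enorm_integral_le_lintegral_enorm _
      _ ≤ (∫⁻ y in Metric.ball z d, ‖u.toFun y‖ₑ ^ q) ^ (1 / q) *
            volume (Metric.ball z d) ^ (1 - 1 / q) := by
          have := lintegral_enorm_le_rpow_mul_measure (μ := volume.restrict (Metric.ball z d))
            u.continuous_toFun.aestronglyMeasurable hq.out
          rwa [Measure.restrict_apply_univ] at this
      _ ≤ ((ENNReal.ofReal V₀)⁻¹ * mNorm s q p V u.toFun ^ q) ^ (1 / q) *
            volume (Metric.ball z d) ^ (1 - 1 / q) := by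
          gcongr
          refine (setLIntegral_le_lintegral _ _).trans
            ((lintegral_enorm_rpow_le_of_le hV₀ hV hVm u.continuous_toFun hq0).trans ?_)
          gcongr
          exact weightedNorm_le_mNorm
      _ = _ := by
          rw [ENNReal.mul_rpow_of_nonneg _ _ (by positivity), ← ENNReal.rpow_mul,
            mul_one_div_cancel hq0.ne', ENNReal.rpow_one, hC]
          ring
  have := ENNReal.toReal_mono (ENNReal.mul_ne_top hCt u.mNorm_ne_top) hmain
  rwa [toReal_enorm, ENNReal.toReal_mul] at this

end TestSpace

variable [hr1 : Fact (1 ≤ r)]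

theorem eLpNorm_weighted (u : Rn n → ℝ) :
    eLpNorm u (ENNReal.ofReal r) (weighted K) = (∫⁻ x, ‖u x‖ₑ ^ r ∂(weighted K)) ^ (1 / r) := by
  have hr0 : 0 < r := by linarith [hr1.out]
  rw [eLpNorm_eq_lintegral_rpow_enorm_toReal (by simpa using hr0) (by simp),
    ENNReal.toReal_ofReal hr0.le]

/-- The inclusion of the test functions into `L^r(K)`. -/
def testInclusion (h : ∀ u : TestSpace n s q p V, MemLp u.toFun (ENNReal.ofReal r) (weighted K)) :
    TestSpace n s q p V →ₗ[ℝ] LrK n r K where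
  toFun u := (h u).toLp
  map_add' u v := MemLp.toLp_add (h u) (h v)
  map_smul' c u := MemLp.toLp_const_smul c (h u)

theorem exists_control_eLpNorm (hs : 0 < s) (hsp : s * p < n) (hr : critExp n s p ≤ r)
    (hrq : r < q) (hVm : AEMeasurable V volume) (hV₀ : 0 < V₀) (hV : ∀ x, V₀ ≤ V x) {t : ℝ≥0∞}
    (ht : ENNReal.ofReal (q / (q - r)) < t)
    (hKt : ∀ Ω : Set (Rn n), MeasurableSet Ω → volume Ω < ∞ → MemLp K t (volume.restrict Ω))
    (hKV : VanishesAtInfinity fun x =>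
      K x * V x ^ (-((r - critExp n s p) / (q - critExp n s p))))
    {ε : ℝ} (hε : 0 < ε) :
    ∃ (ι : Type) (_ : Fintype ι) (P : TestSpace n s q p V →L[ℝ] (ι → ℝ)),
      ∀ u, ‖u‖ ≤ 1 → ‖P u‖ ≤ 1 →
        eLpNorm u.toFun (ENNReal.ofReal r) (weighted K) ≤ ENNReal.ofReal ε := by
  have hr0 : 0 < r := by linarith [hr1.out]
  obtain ⟨T, d, η, hη, hT⟩ := exists_finset_lintegral_weighted_le (ε := ENNReal.ofReal ε ^ r)
    hp.out hs hsp hr hrq hVm hV₀ hV ht hKt hKV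
    (ENNReal.rpow_pos (ENNReal.ofReal_pos.2 hε) (by simp))
  choose L hL using fun z : Rn n =>
    TestSpace.exists_clm_setIntegral_ball (s := s) (p := p) (q := q) hVm hV₀ hV z d
  -- Dividing by `η` turns the condition that the integrals are at most `η` into `‖P u‖ ≤ 1` for the
  -- sup norm.
  refine ⟨Fin T.card, inferInstance, ContinuousLinearMap.pi fun i => η⁻¹ • L (T.equivFin.symm i),
    fun u hu hPu => ?_⟩
  rw [eLpNorm_weighted, one_div, ENNReal.rpow_inv_le_iff hr0]
  refine hT u.toFun u.continuous_toFun u.hasCompactSupport_toFun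
    (by simpa using TestSpace.mNorm_le_ofReal hu) fun z hz => ?_
  have h1 := (norm_le_pi_norm _ (T.equivFin ⟨z, hz⟩)).trans hPu
  rw [ContinuousLinearMap.pi_apply, Equiv.symm_apply_apply, smul_apply, hL,
    norm_smul, Real.norm_of_nonneg (inv_nonneg.2 hη.le), inv_mul_le_iff₀ hη, mul_one] at h1
  exact h1

end Embedding

/-! ### Lower semicontinuity of the norm under almost everywhere convergence -/

/-- Fatou's lemma with a uniform bound on the integrals. -/
theorem lintegral_le_of_tendsto_ae {α : Type*} [MeasurableSpace α] {μ : Measure α}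
    {f : ℕ → α → ℝ≥0∞} {g : α → ℝ≥0∞} {C : ℝ≥0∞} (hf : ∀ j, AEMeasurable (f j) μ)
    (hlim : ∀ᵐ x ∂μ, Filter.Tendsto (fun j => f j x) Filter.atTop (nhds (g x)))
    (hC : ∀ᶠ j in Filter.atTop, ∫⁻ x, f j x ∂μ ≤ C) : ∫⁻ x, g x ∂μ ≤ C := by
  calc ∫⁻ x, g x ∂μ = ∫⁻ x, Filter.liminf (fun j => f j x) Filter.atTop ∂μ :=
        lintegral_congr_ae (hlim.mono fun x hx => hx.liminf_eq.symm)
    _ ≤ Filter.liminf (fun j => ∫⁻ x, f j x ∂μ) Filter.atTop := lintegral_liminf_le' hf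
    _ ≤ C := Filter.liminf_le_of_frequently_le' hC.frequently

section Fatou

variable {n : ℕ} {s p q : ℝ} {V w : Rn n → ℝ} {v : ℕ → Rn n → ℝ}

theorem weightedNorm_le_of_tendsto_ae (hq : 0 < q) (hv : ∀ j, Continuous (v j))
    (hlim : ∀ᵐ x, Filter.Tendsto (fun j => v j x) Filter.atTop (nhds (w x))) {C : ℝ≥0∞}
    (hC : ∀ᶠ j in Filter.atTop, weightedNorm V q (v j) ≤ C) : weightedNorm V q w ≤ C := by
  unfold weightedNorm at hC ⊢
  simp only [one_div, ENNReal.rpow_inv_le_iff hq] at hC ⊢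
  have hm := fun j => (hv j).measurable
  refine lintegral_le_of_tendsto_ae (fun j => by fun_prop)
    (Filter.Eventually.mono ((withDensity_absolutelyContinuous _ _).ae_le hlim) fun x hx => ?_) hC
  exact (ENNReal.continuous_rpow_const.tendsto _).comp hx.enorm

theorem gagliardo_le_of_tendsto_ae (hp : 0 < p) (hv : ∀ j, Continuous (v j)) (hw : Continuous w)
    (hlim : ∀ᵐ x, Filter.Tendsto (fun j => v j x) Filter.atTop (nhds (w x))) {C : ℝ≥0∞}
    (hC : ∀ᶠ j in Filter.atTop, gagliardo s p (v j) ≤ C) : gagliardo s p w ≤ C := by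
  have hC' : ∀ᶠ j in Filter.atTop,
      (∫⁻ z, ‖v j z.1 - v j z.2‖ₑ ^ p ∂(kernelMeasure n s p)) ^ (1 / p) ≤ C :=
    hC.mono fun j hj => by rwa [← gagliardo_eq (hv j)]
  rw [gagliardo_eq hw]
  simp only [one_div, ENNReal.rpow_inv_le_iff hp] at hC' ⊢
  have hm := fun j => (hv j).measurable
  -- Null sets pull back to null sets under both projections, so the differences converge almost
  -- everywhere on the product.
  have h1 : ∀ᵐ z : Rn n × Rn n, Filter.Tendsto (fun j => v j z.1) Filter.atTop (nhds (w z.1)) :=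
    Measure.quasiMeasurePreserving_fst.ae hlim
  have h2 : ∀ᵐ z : Rn n × Rn n, Filter.Tendsto (fun j => v j z.2) Filter.atTop (nhds (w z.2)) :=
    Measure.quasiMeasurePreserving_snd.ae hlim
  refine lintegral_le_of_tendsto_ae (fun j => by fun_prop)
    (Filter.Eventually.mono ((withDensity_absolutelyContinuous _ _).ae_le (h1.and h2))
      fun z hz => ?_) hC'
  exact (ENNReal.continuous_rpow_const.tendsto _).comp (hz.1.sub hz.2).enorm

/-- The two summands are bounded separately by `C`; the resulting factor `2` is harmless for
convergence to `0`. -/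
theorem mNorm_le_of_tendsto_ae (hq : 0 < q) (hp : 0 < p) (hv : ∀ j, Continuous (v j))
    (hw : Continuous w)
    (hlim : ∀ᵐ x, Filter.Tendsto (fun j => v j x) Filter.atTop (nhds (w x))) {C : ℝ≥0∞}
    (hC : ∀ᶠ j in Filter.atTop, mNorm s q p V (v j) ≤ C) : mNorm s q p V w ≤ C + C :=
  add_le_add
    (weightedNorm_le_of_tendsto_ae hq hv hlim (hC.mono fun _ h => weightedNorm_le_mNorm.trans h))
    (gagliardo_le_of_tendsto_ae hp hv hw hlim (hC.mono fun _ h => gagliardo_le_mNorm.trans h))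

end Fatou

/-! ### Injectivity of the extension -/

section Injective

variable {n : ℕ} {s p q r : ℝ} {K V : Rn n → ℝ} [hq : Fact (1 ≤ q)] [hp : Fact (1 ≤ p)]

/-- A Cauchy sequence of test functions that tends to `0` almost everywhere tends to `0` in
norm. -/
theorem TestSpace.eventually_norm_le_of_cauchySeq {u : ℕ → TestSpace n s q p V}
    (hu : CauchySeq u)
    (hlim : ∀ᵐ x, Filter.Tendsto (fun j => (u j).toFun x) Filter.atTop (nhds 0))
    {ε : ℝ} (hε : 0 < ε) : ∀ᶠ k in Filter.atTop, ‖u k‖ ≤ ε + ε := by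
  obtain ⟨N, hN⟩ := Metric.cauchySeq_iff.1 hu ε hε
  filter_upwards [Filter.eventually_ge_atTop N] with k hk
  have hw : mNorm s q p V (u k).toFun ≤ ENNReal.ofReal ε + ENNReal.ofReal ε := by
    -- As `j → ∞` the differences `u k - u j` tend almost everywhere to `u k`, while their norms
    -- stay at most `ε`.
    refine mNorm_le_of_tendsto_ae (v := fun j => (u k - u j).toFun) (by linarith [hq.out])
      (by linarith [hp.out]) (fun j => (u k - u j).continuous_toFun) (u k).continuous_toFun
      (hlim.mono fun x hx => ?_) ?_
    · have := hx.const_sub ((u k).toFun x)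
      rwa [sub_zero] at this
    · filter_upwards [Filter.eventually_ge_atTop N] with j hj
      exact TestSpace.mNorm_le_ofReal (by simpa [dist_eq_norm] using (hN k hk j hj).le)
  have := ENNReal.toReal_mono (by simp) hw
  rwa [← ENNReal.ofReal_add hε.le hε.le, ENNReal.toReal_ofReal (by linarith)] at this

/-- An extension of the inclusion of the test functions into `L^r(K)` is injective. -/
theorem injective_of_ae_eq_toFun [hr : Fact (1 ≤ r)] (hKm : AEMeasurable K volume)
    (hK : ∀ x, 0 < K x) (ι : MSpace n s q p V →L[ℝ] LrK n r K)
    (hι : ∀ u : TestSpace n s q p V, ι (u : MSpace n s q p V) =ᵐ[volume] u.toFun) :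
    Function.Injective ι := by
  rw [injective_iff_map_eq_zero]
  intro U hU
  obtain ⟨u, hu, hlim⟩ := mem_closure_iff_seq_limit.1
    (UniformSpace.Completion.denseRange_coe (α := TestSpace n s q p V) U)
  choose w hw using hu
  obtain rfl : (fun k => (w k : MSpace n s q p V)) = u := funext hw
  -- Positivity of `K` makes null sets of `K dx` Lebesgue null, so convergence in `L^r(K)` gives
  -- Lebesgue almost everywhere convergence of a subsequence.
  have hac : volume ≪ weighted K := withDensity_absolutelyContinuous' hKm.ennreal_ofReal
    (Filter.Eventually.of_forall fun x => by simpa using hK x)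
  have hlim0 : Filter.Tendsto (fun k => ι (w k : MSpace n s q p V)) Filter.atTop (nhds 0) := by
    simpa [hU, Function.comp_def] using (ι.continuous.tendsto U).comp hlim
  obtain ⟨φ, hφ, hae⟩ := (tendstoInMeasure_of_tendsto_Lp hlim0).exists_seq_tendsto_ae
  have hae' : ∀ᵐ x, Filter.Tendsto (fun j => (w (φ j)).toFun x) Filter.atTop (nhds 0) := by
    filter_upwards [hac.ae_le hae, hac.ae_le (Lp.coeFn_zero ℝ (ENNReal.ofReal r) (weighted K)),
      ae_all_iff.2 fun j => hι (w (φ j))] with x hx h0 hx'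
    simp only [hx', h0] at hx
    exact hx
  have hcauchy : CauchySeq fun j => w (φ j) := by
    have := (hlim.comp hφ.tendsto_atTop).cauchySeq
    rw [Metric.cauchySeq_iff] at this ⊢
    simpa only [Function.comp_apply, UniformSpace.Completion.dist_eq] using this
  have hnorm : Filter.Tendsto (fun j => ‖w (φ j)‖) Filter.atTop (nhds ‖U‖) := by
    simpa [Function.comp_def] using (hlim.comp hφ.tendsto_atTop).norm
  refine norm_le_zero_iff.1 (le_of_forall_pos_le_add fun ε hε => ?_)
  have := le_of_tendsto hnorm
    (TestSpace.eventually_norm_le_of_cauchySeq hcauchy hae' (half_pos hε))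
  linarith

end Injective

/-! ### Test functions belong to `L^r(K)` -/

section Membership

variable {n : ℕ} {s p q r : ℝ} {K V : Rn n → ℝ} [hq : Fact (1 ≤ q)] [hp : Fact (1 ≤ p)]

/-- Scaling reduces membership in `L^r(K)` to small test functions. -/
theorem memLp_toFun_of_control
    (h : ∃ (ι : Type) (_ : Fintype ι) (P : TestSpace n s q p V →L[ℝ] (ι → ℝ)),
      ∀ u, ‖u‖ ≤ 1 → ‖P u‖ ≤ 1 → eLpNorm u.toFun (ENNReal.ofReal r) (weighted K) ≤ 1)
    (u : TestSpace n s q p V) : MemLp u.toFun (ENNReal.ofReal r) (weighted K) := by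
  obtain ⟨ι, _, P, hP⟩ := h
  -- This factor brings both `‖c • u‖` and `‖P (c • u)‖` below `1`.
  set c : ℝ := (1 + ‖u‖ + ‖P u‖)⁻¹ with hc
  have h1 := norm_nonneg u
  have h2 := norm_nonneg (P u)
  have hpos : 0 < 1 + ‖u‖ + ‖P u‖ := by positivity
  have hc0 : 0 < c := inv_pos.2 hpos
  have hcu := hP (c • u)
    (by rw [norm_smul, Real.norm_of_nonneg hc0.le, hc, inv_mul_le_iff₀ hpos]; linarith)
    (by rw [map_smul, norm_smul, Real.norm_of_nonneg hc0.le, hc, inv_mul_le_iff₀ hpos]; linarith)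
  have hmem : MemLp (c • u).toFun (ENNReal.ofReal r) (weighted K) :=
    ⟨(c • u).continuous_toFun.aestronglyMeasurable, hcu.trans_lt ENNReal.one_lt_top⟩
  have := hmem.const_smul c⁻¹
  rwa [show c⁻¹ • (c • u).toFun = u.toFun from inv_smul_smul₀ hc0.ne' u.toFun] at this

end Membership

end FracSobolev

end

/-! ### The compact embedding -/

open FracSobolev in
theorem theorem5 (n : ℕ) (hn : 2 ≤ n) (s p q r : ℝ)
    [Fact (1 ≤ p)] [Fact (1 ≤ q)] [Fact (1 ≤ r)]
    (hs0 : 0 < s) (hs1 : s < 1) (hsp : s * p < n)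
    (hr : critExp n s p ≤ r) (hrq : r < q)
    (K V : Rn n → ℝ) (hK : ∀ x, 0 < K x)
    (hVm : AEMeasurable V volume) (V₀ : ℝ) (hV₀ : 0 < V₀) (hV : ∀ x, V₀ ≤ V x)
    (t : ℝ≥0∞) (ht : ENNReal.ofReal (q / (q - r)) < t)
    (hKt : ∀ Ω : Set (Rn n), MeasurableSet Ω → volume Ω < ∞ → MemLp K t (volume.restrict Ω))
    (hKV : VanishesAtInfinity fun x =>
      K x * V x ^ (-((r - critExp n s p) / (q - critExp n s p)))) :
    ∃ ι : MSpace n s q p V →L[ℝ] LrK n r K,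
      (∀ u : TestSpace n s q p V, ι (u : MSpace n s q p V) =ᵐ[volume] u.toFun) ∧
      Function.Injective ι ∧ IsCompactOperator ι := by
  have hcontrol := fun (ε : ℝ) (hε : 0 < ε) =>
    exists_control_eLpNorm hs0 hsp hr hrq hVm hV₀ hV ht hKt hKV hε
  have hmem : ∀ u : TestSpace n s q p V, MemLp u.toFun (ENNReal.ofReal r) (weighted K) :=
    memLp_toFun_of_control (by simpa using hcontrol 1 one_pos)
  have hfc : IsFinitelyControlled (testInclusion hmem) := fun ε hε => by
    obtain ⟨κ, hκ, P, hP⟩ := hcontrol ε hε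
    refine ⟨κ, hκ, P, fun u hu hPu => ?_⟩
    have h := ENNReal.toReal_mono ENNReal.ofReal_ne_top (hP u hu hPu)
    rw [ENNReal.toReal_ofReal hε.le] at h
    exact (Lp.norm_toLp u.toFun (hmem u)).trans_le h
  obtain ⟨ι, hι, hcomp⟩ := hfc.exists_isCompactOperator
  have hKm := aemeasurable_of_forall_memLp hKt
  have hac : volume ≪ weighted K := withDensity_absolutelyContinuous' hKm.ennreal_ofReal
    (Filter.Eventually.of_forall fun x => by simpa using hK x)
  have hae : ∀ u : TestSpace n s q p V, ι (u : MSpace n s q p V) =ᵐ[volume] u.toFun := fun u => by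
    rw [hι u]
    exact hac.ae_le (hmem u).coeFn_toLp
  exact ⟨ι, hae, injective_of_ae_eq_toFun hKm hK ι hae, hcomp⟩
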